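/- **Setting.** Let $d\in\{2,3\}$, $k>0$, and let $\Omega_1\subset\subset\Omega_2\subset\subset\Omega_3\subset\subset\Omega$ be smooth connected bounded open subsets of $\mathbb R^d$. Let $A$ be a bounded measurable real $d\times d$ matrix function and $\Sigma$ a measurable real function on $\Omega$ such that, for some $0<\Lambda<\infty$, $\frac1\Lambda|\xi|^2\le\langle A(x)\xi,\xi\rangle\le\Lambda|\xi|^2$ for all $\xi\in\mathbb R^d$ and a.e. $x\in\Omega$, and $0<\operatorname{ess\,inf}_\Omega\Sigma\le\operatorname{ess\,sup}_\Omega\Sigma<\infty$. For a diffeomorphism $T$ put, with $x=T^{-1}(y)$ and $J(x)=|\det DT(x)|$, $$T_*a(y)=\frac{DT(x)\,a(x)\,DT(x)^T}{J(x)},\qquad T_*\sigma(y)=\frac{\sigma(x)}{J(x)},\qquad T_*f(y)=\frac{f(x)}{J(x)} .$$ Assume that the media $(A,\Sigma)$ in $\Omega_3\setminus\Omega_2$ and $(-A,-\Sigma)$ in $\Omega_2\setminus\Omega_1$ are *reflecting complementary*, by means of maps $F$ and $G$. That is, there are $x_1\in\Omega_1$, $x_2\in\Omega_3$ and a smooth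 open set $\Omega_4\supset\Omega_3$ such that: * $F:\Omega_2\setminus\{x_1\}\to\Omega_4\setminus\bar\Omega_2$ is a diffeomorphism which restricts to a diffeomorphism $\Omega_2\setminus\bar\Omega_1\to\Omega_3\setminus\bar\Omega_2$, and $F_*A=A$, $F_*\Sigma=\Sigma$ a.e. in $\Omega_3\setminus\bar\Omega_2$; * $G:\Omega_4\setminus\bar\Omega_3\to\Omega_3\setminus\{x_2\}$ is a diffeomorphism; * $F(x)=x$ on $\partial\Omega_2$ and $G(x)=x$ on $\partial\Omega_3$, where $F$ and $G$ here denote diffeomorphism extensions to neighbourhoods of $\partial\Omega_2$ and $\partial\Omega_3$; * $G\circ F$, defined on $\Omega_1\setminus\{x_1\}$ and completed by $G\circ F(x_1)=x_2$, is a diffeomorphism from $\Omega_1$ onto $\Omega_3$. Set $(\hat A,\hat\Sigma,\hat f)=(A,\Sigma,f)$ in $\Omega\setminus\Omega_3$ and $(\hat A,\hat\Sigma,\hat f)=(G_*F_*A,\,G_*F_*\Sigma,\,G_*F_*f)$ in $\Omega_3$. Assume that the only $v\in H^1(\Omega\setminus\bar\Omega_2)$ with $\operatorname{div}(A\nabla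 v)+k^2\Sigma v=0$ in $\Omega\setminus\bar\Omega_2$ and $v=0$ on $\partial\Omega\cup\partial\Omega_2$ is $v=0$, and that the only $v\in H^1(\Omega)$ with $\operatorname{div}(\hat A\nabla v)+k^2\hat\Sigma v=0$ in $\Omega$ and $v=0$ on $\partial\Omega$ is $v=0$. All functions are complex valued, equations are meant in the weak sense, and boundary values and conormal derivatives in the usual trace sense (through Green's formula). On $\partial\Omega_3$, $\eta$ is the unit normal pointing out of $\Omega_3$; "ext" and "int" denote values taken from outside and from inside $\Omega_3$, and $[w]=w|_{\rm ext}-w|_{\rm int}$. **Compatibility.** $f\in L^2(\Omega)$ is *compatible with the system* if there are $U,V\in H^1(\Omega_3\setminus\bar\Omega_2)$ with $$\operatorname{div}(A\nabla U)+k^2\Sigma U=F_*f-f\ \text{ in }\Omega_3\setminus\bar\Omega_2,\qquad U=0,\ \ A\nabla U\cdot\eta=0\ \text{ on }\partial\Omega_2,$$ $$\operatorname{div}(A\nabla V)+k^2\Sigma V=f\ \text{ in }\Omega_3\setminus\bar\Omega_2,\qquad V=W|_{\rm ext},\ \ A\nabla V\cdot\eta=A\nabla W\cdot\eta|_{\rm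 ext}\ \text{ on }\partial\Omega_3,$$ where $W\in H^1(\Omega\setminus\partial\Omega_3)$ is the unique solution of $$\operatorname{div}(\hat A\nabla W)+k^2\hat\Sigma W=\hat f\ \text{ in }\Omega\setminus\partial\Omega_3,\quad W=0\ \text{ on }\partial\Omega,\quad [W]=-U,\ \ [\hat A\nabla W\cdot\eta]=-A\nabla U\cdot\eta\ \text{ on }\partial\Omega_3 .$$ **Corollary.** Let $f\in L^2(\Omega)$ vanish a.e. in $\Omega_3$. Let $W\in H^1_0(\Omega)$ be the solution of $\operatorname{div}(\hat A\nabla W)+k^2\hat\Sigma W=f$ in $\Omega$, and suppose that there is a solution $V\in H^1(\Omega_3\setminus\bar\Omega_2)$ of the Cauchy problem $$\operatorname{div}(A\nabla V)+k^2\Sigma V=0\ \text{ in }\Omega_3\setminus\bar\Omega_2,\qquad V=W|_{\rm ext},\ \ A\nabla V\cdot\eta=A\nabla W\cdot\eta|_{\rm ext}\ \text{ on }\partial\Omega_3 .$$ Then $f$ is compatible with the system. -/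

import Mathlib

open MeasureTheory Set Filter Topology
open scoped ContDiff Matrix

noncomputable section

namespace ReflCompl

/-- Euclidean space `ℝ^d`. -/
abbrev E (d : ℕ) := EuclideanSpace ℝ (Fin d)

/-- The `i`-th partial derivative. -/
def pd {d : ℕ} {V : Type*} [NormedAddCommGroup V] [NormedSpace ℝ V]
    (φ : E d → V) (i : Fin d) (x : E d) : V :=
  fderiv ℝ φ x (EuclideanSpace.single i 1)

/-- Smooth functions on `ℝ^d` with compact support contained in `N`. -/
def IsTest {d : ℕ} {V : Type*} [NormedAddCommGroup V] [NormedSpace ℝ V]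
    (N : Set (E d)) (φ : E d → V) : Prop :=
  ContDiff ℝ ∞ φ ∧ HasCompactSupport φ ∧ tsupport φ ⊆ N

/-! ### Domains and diffeomorphisms -/

/-- Near each of its boundary points, `D` is mapped by a smooth change of coordinates onto one
side of a coordinate hyperplane. -/
def SmoothBoundary {d : ℕ} (D : Set (E d)) : Prop :=
  ∀ x ∈ frontier D, ∃ (e : OpenPartialHomeomorph (E d) (E d)) (i : Fin d),
    x ∈ e.source ∧ ContDiffOn ℝ ∞ e e.source ∧ ContDiffOn ℝ ∞ e.symm e.target ∧
      ∀ y ∈ e.source, (y ∈ D ↔ 0 < e y i)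

/-- Smooth connected bounded open sets. -/
structure IsSmoothDomain {d : ℕ} (D : Set (E d)) : Prop where
  isOpen : IsOpen D
  isConnected : IsConnected D
  isBounded : Bornology.IsBounded D
  smooth : SmoothBoundary D

/-- `F` restricts to a diffeomorphism from the open set `D₁` onto the open set `D₂`. -/
def IsDiffeoOn {d : ℕ} (F : E d → E d) (D₁ D₂ : Set (E d)) : Prop :=
  IsOpen D₁ ∧ IsOpen D₂ ∧ ContDiffOn ℝ ∞ F D₁ ∧
    ∃ F' : E d → E d, ContDiffOn ℝ ∞ F' D₂ ∧ MapsTo F D₁ D₂ ∧ MapsTo F' D₂ D₁ ∧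
      InvOn F' F D₁ D₂

/-- `F(x) = x` on the part `S` of the boundary of `D`: some extension of `F|_D` to a
diffeomorphism of a neighbourhood of `S` is the identity on `S`. -/
def FixesBoundary {d : ℕ} (F : E d → E d) (D S : Set (E d)) : Prop :=
  ∃ (F' : E d → E d) (N N' : Set (E d)), S ⊆ N ∧ IsDiffeoOn F' N N' ∧
    EqOn F' F (N ∩ D) ∧ ∀ x ∈ S, F' x = x

/-- The Jacobian matrix `DF(x)`. -/
def jac {d : ℕ} (F : E d → E d) (x : E d) : Matrix (Fin d) (Fin d) ℝ :=
  Matrix.of fun i j => pd F j x i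

/-- `F_* a (y) = DF(x) a(x) DF(x)ᵀ / |det DF(x)|`, `x = F⁻¹(y)`, where `F` is regarded as a map
defined on `D`. -/
def pushMatrix {d : ℕ} (F : E d → E d) (D : Set (E d))
    (a : E d → Matrix (Fin d) (Fin d) ℝ) (y : E d) : Matrix (Fin d) (Fin d) ℝ :=
  let x := Function.invFunOn F D y
  |(jac F x).det|⁻¹ • (jac F x * a x * (jac F x)ᵀ)

/-- `F_* g (y) = g(x) / |det DF(x)|`, `x = F⁻¹(y)`, where `F` is regarded as a map defined on
`D`. -/
def pushScalar {d : ℕ} {V : Type*} [NormedAddCommGroup V] [NormedSpace ℝ V]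
    (F : E d → E d) (D : Set (E d)) (g : E d → V) (y : E d) : V :=
  let x := Function.invFunOn F D y
  |(jac F x).det|⁻¹ • g x

/-! ### Sobolev functions, weak solutions and boundary values -/

/-- An element of the complex Sobolev space `H¹(D)`, `D` open: a square integrable function
together with its square integrable weak gradient. -/
structure H1 {d : ℕ} (D : Set (E d)) where
  val : E d → ℂ
  grad : E d → EuclideanSpace ℂ (Fin d)
  memLp_val : MemLp val 2 (volume.restrict D)
  memLp_grad : MemLp grad 2 (volume.restrict D)
  weak : ∀ φ : E d → ℝ, IsTest D φ → ∀ i,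
    ∫ x in D, val x * ((pd φ i x : ℝ) : ℂ) = - ∫ x in D, grad x i * (φ x : ℂ)

theorem IsTest.eq_zero {d : ℕ} {N : Set (E d)} {φ : E d → ℝ} (h : IsTest N φ) {x : E d}
    (hx : x ∉ N) : φ x = 0 :=
  image_eq_zero_of_notMem_tsupport fun h' => hx (h.2.2 h')

theorem IsTest.pd_eq_zero {d : ℕ} {N : Set (E d)} {φ : E d → ℝ} (h : IsTest N φ) {x : E d}
    (hx : x ∉ N) (i : Fin d) : pd φ i x = 0 := by
  have h0 : fderiv ℝ φ x = 0 := by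
    by_contra hne
    exact hx (h.2.2 (support_fderiv_subset ℝ hne))
  simp [pd, h0]

/-- Restriction of an `H¹` function to a smaller open set. -/
def H1.restrict {d : ℕ} {D D' : Set (E d)} (u : H1 D) (h : D' ⊆ D) : H1 D' where
  val := u.val
  grad := u.grad
  memLp_val := u.memLp_val.mono_measure (Measure.restrict_mono h le_rfl)
  memLp_grad := u.memLp_grad.mono_measure (Measure.restrict_mono h le_rfl)
  weak := fun φ hφ i => by
    have hφ' : IsTest D φ := ⟨hφ.1, hφ.2.1, hφ.2.2.trans h⟩
    have := u.weak φ hφ' i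
    rw [setIntegral_eq_integral_of_forall_compl_eq_zero
        (fun x hx => by simp [hφ'.pd_eq_zero hx]),
      setIntegral_eq_integral_of_forall_compl_eq_zero
        (fun x hx => by simp [hφ'.eq_zero hx])] at this
    rw [setIntegral_eq_integral_of_forall_compl_eq_zero
        (fun x hx => by simp [hφ.pd_eq_zero hx]),
      setIntegral_eq_integral_of_forall_compl_eq_zero
        (fun x hx => by simp [hφ.eq_zero hx]), this]

/-- `u = v` as elements of `H¹(D)`. -/
def H1.Eq {d : ℕ} {D : Set (E d)} (u v : H1 D) : Prop :=
  u.val =ᵐ[volume.restrict D] v.val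

/-- `u ∈ H¹₀(D)`: `u` is a limit in `H¹(D)` of smooth functions with compact support in `D`. -/
def H1.IsH10 {d : ℕ} {D : Set (E d)} (u : H1 D) : Prop :=
  ∃ ψ : ℕ → E d → ℂ, (∀ n, IsTest D (ψ n)) ∧
    Tendsto (fun n => eLpNorm (fun x => ψ n x - u.val x) 2 (volume.restrict D)) atTop (𝓝 0) ∧
    Tendsto (fun n => eLpNorm (fun x => WithLp.toLp 2 (fun i => pd (ψ n) i x) - u.grad x) 2
      (volume.restrict D)) atTop (𝓝 0)

/-- The trace of `u ∈ H¹(D)` on `∂D`, as a functional on smooth vector fields: by Green's formula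
this is `∫_{∂D} u φ · η`, with `η` the unit normal on `∂D` pointing out of `D`. If `D` lies on both
sides of a piece of `∂D`, then both sides contribute, each with its own outward normal. -/
def traceFun {d : ℕ} {D : Set (E d)} (u : H1 D) (φ : E d → E d) : ℂ :=
  ∫ x in D, (u.val x * ((∑ i, pd φ i x i : ℝ) : ℂ) + ∑ i, u.grad x i * (φ x i : ℂ))

/-- The conormal derivative on `∂D` of a solution `u ∈ H¹(D)` of `div (a ∇u) + c u = h` in `D`, as
a functional on smooth functions: by Green's formula this is `∫_{∂D} (a ∇u · η) φ`, with `η` the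
unit normal on `∂D` pointing out of `D`, with the same convention on two-sided pieces. -/
def conormalFun {d : ℕ} {D : Set (E d)} (a : E d → Matrix (Fin d) (Fin d) ℝ) (c : E d → ℝ)
    (h : E d → ℂ) (u : H1 D) (φ : E d → ℝ) : ℂ :=
  ∫ x in D, ((∑ i, (∑ j, (a x i j : ℂ) * u.grad x j) * ((pd φ i x : ℝ) : ℂ))
    + (h x - (c x : ℂ) * u.val x) * (φ x : ℂ))

/-- `u` is a weak solution of `div (a ∇u) + c u = h` in `D`. -/
def IsWeakSol {d : ℕ} {D : Set (E d)} (a : E d → Matrix (Fin d) (Fin d) ℝ) (c : E d → ℝ)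
    (h : E d → ℂ) (u : H1 D) : Prop :=
  ∀ φ : E d → ℝ, IsTest D φ →
    ∫ x in D, ((∑ i, (∑ j, (a x i j : ℂ) * u.grad x j) * ((pd φ i x : ℝ) : ℂ))
      - (c x : ℂ) * u.val x * (φ x : ℂ)) = - ∫ x in D, h x * (φ x : ℂ)

/-- `u = 0` on the part `∂D ∩ N` of the boundary (`N` open), in the sense of traces. -/
def ZeroTrace {d : ℕ} {D : Set (E d)} (u : H1 D) (N : Set (E d)) : Prop :=
  ∀ φ : E d → E d, IsTest N φ → traceFun u φ = 0

/-! ### The media -/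

/-- The regions `Ω₁, Ω₂, Ω₃, Ω` and the coefficients `A`, `Σ` (here `S`). -/
structure Medium (d : ℕ) where
  Ω₁ : Set (E d)
  Ω₂ : Set (E d)
  Ω₃ : Set (E d)
  Ω : Set (E d)
  A : E d → Matrix (Fin d) (Fin d) ℝ
  S : E d → ℝ

/-- The standing assumptions on the regions and coefficients. -/
structure Medium.Admissible {d : ℕ} (M : Medium d) : Prop where
  dom₁ : IsSmoothDomain M.Ω₁
  dom₂ : IsSmoothDomain M.Ω₂
  dom₃ : IsSmoothDomain M.Ω₃
  dom : IsSmoothDomain M.Ω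
  sub₁₂ : closure M.Ω₁ ⊆ M.Ω₂
  sub₂₃ : closure M.Ω₂ ⊆ M.Ω₃
  sub₃ : closure M.Ω₃ ⊆ M.Ω
  meas_A : ∀ i j, AEMeasurable (fun x => M.A x i j) (volume.restrict M.Ω)
  bdd_A : ∃ C : ℝ, ∀ᵐ x ∂(volume.restrict M.Ω), ∀ i j, |M.A x i j| ≤ C
  elliptic : ∃ L : ℝ, 0 < L ∧ ∀ᵐ x ∂(volume.restrict M.Ω), ∀ ξ : Fin d → ℝ,
    1 / L * (ξ ⬝ᵥ ξ) ≤ (M.A x *ᵥ ξ) ⬝ᵥ ξ ∧ (M.A x *ᵥ ξ) ⬝ᵥ ξ ≤ L * (ξ ⬝ᵥ ξ)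
  meas_S : AEMeasurable M.S (volume.restrict M.Ω)
  bdd_S : ∃ c C : ℝ, 0 < c ∧ ∀ᵐ x ∂(volume.restrict M.Ω), c ≤ M.S x ∧ M.S x ≤ C

/-- The data of a pair of reflections: `F` is a map on `Ω₂ \ {x₁}`, and `G` is a map on
`Ω₄ \ closure Ω₃`. -/
structure Reflection (d : ℕ) where
  Ω₄ : Set (E d)
  x₁ : E d
  x₂ : E d
  F : E d → E d
  G : E d → E d

variable {d : ℕ}

/-- `F_* A`, for the map `F` on `Ω₂ \ {x₁}`. -/
def Medium.pushA (M : Medium d) (R : Reflection d) : E d → Matrix (Fin d) (Fin d) ℝ :=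
  pushMatrix R.F (M.Ω₂ \ {R.x₁}) M.A

/-- `F_* g`, for the map `F` on `Ω₂ \ {x₁}`. -/
def Medium.pushF {V : Type*} [NormedAddCommGroup V] [NormedSpace ℝ V] (M : Medium d)
    (R : Reflection d) (g : E d → V) : E d → V :=
  pushScalar R.F (M.Ω₂ \ {R.x₁}) g

open Classical in
/-- `A` outside `Ω₃` and `G_* F_* A` in `Ω₃`. -/
def Medium.hatA (M : Medium d) (R : Reflection d) (x : E d) : Matrix (Fin d) (Fin d) ℝ :=
  if x ∈ M.Ω₃ then pushMatrix R.G (R.Ω₄ \ closure M.Ω₃) (M.pushA R) x else M.A x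

open Classical in
/-- `g` outside `Ω₃` and `G_* F_* g` in `Ω₃`; used for `Σ` and for the source. -/
def Medium.hat {V : Type*} [NormedAddCommGroup V] [NormedSpace ℝ V] (M : Medium d)
    (R : Reflection d) (g : E d → V) (x : E d) : V :=
  if x ∈ M.Ω₃ then pushScalar R.G (R.Ω₄ \ closure M.Ω₃) (M.pushF R g) x else g x

open Classical in
/-- The media `(A, Σ)` in `Ω₃ \ Ω₂` and `(-A, -Σ)` in `Ω₂ \ Ω₁` are reflecting complementary, by
means of the reflections `R`. -/
structure Medium.ReflectedBy (M : Medium d) (R : Reflection d) : Prop where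
  diffeo_F : IsDiffeoOn R.F (M.Ω₂ \ closure M.Ω₁) (M.Ω₃ \ closure M.Ω₂)
  push_A : ∀ᵐ x ∂(volume.restrict (M.Ω₃ \ closure M.Ω₂)), M.pushA R x = M.A x
  push_S : ∀ᵐ x ∂(volume.restrict (M.Ω₃ \ closure M.Ω₂)), M.pushF R M.S x = M.S x
  fix_F : FixesBoundary R.F (M.Ω₂ \ {R.x₁}) (frontier M.Ω₂)
  mem_x₁ : R.x₁ ∈ M.Ω₁
  open₄ : IsOpen R.Ω₄
  smooth₄ : SmoothBoundary R.Ω₄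
  sub₃₄ : M.Ω₃ ⊆ R.Ω₄
  diffeo_F_ext : IsDiffeoOn R.F (M.Ω₂ \ {R.x₁}) (R.Ω₄ \ closure M.Ω₂)
  mem_x₂ : R.x₂ ∈ M.Ω₃
  diffeo_G : IsDiffeoOn R.G (R.Ω₄ \ closure M.Ω₃) (M.Ω₃ \ {R.x₂})
  fix_G : FixesBoundary R.G (R.Ω₄ \ closure M.Ω₃) (frontier M.Ω₃)
  maps_F : MapsTo R.F (M.Ω₁ \ {R.x₁}) (R.Ω₄ \ closure M.Ω₃)
  diffeo_GF : IsDiffeoOn (fun x => if x = R.x₁ then R.x₂ else R.G (R.F x)) M.Ω₁ M.Ω₃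

/-- The coefficient `k² Σ`. -/
def coef (k : ℝ) (S : E d → ℝ) (x : E d) : ℝ := k ^ 2 * S x

/-- The homogeneous Dirichlet problems for `(A, Σ)` in `Ω \ closure Ω₂` and for the reflected
coefficients in `Ω` have only the zero solution in `H¹`. -/
structure Medium.WellPosed (M : Medium d) (R : Reflection d) (k : ℝ) : Prop where
  outer : ∀ v : H1 (M.Ω \ closure M.Ω₂),
    IsWeakSol M.A (coef k M.S) 0 v → ZeroTrace v univ →
      ∀ᵐ x ∂(volume.restrict (M.Ω \ closure M.Ω₂)), v.val x = 0
  full : ∀ v : H1 M.Ω,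
    IsWeakSol (M.hatA R) (coef k (M.hat R M.S)) 0 v → ZeroTrace v univ →
      ∀ᵐ x ∂(volume.restrict M.Ω), v.val x = 0

/-- The Cauchy problem for `U` in `Ω₃ \ closure Ω₂`: equation with source `F_* f - f`, and `U = 0`,
`A ∇U · η = 0` on `∂Ω₂` (which is the part of the boundary inside the open set `Ω₃`). -/
structure Medium.SolvesU (M : Medium d) (R : Reflection d) (k : ℝ) (f : E d → ℂ)
    (U : H1 (M.Ω₃ \ closure M.Ω₂)) : Prop where
  eqn : IsWeakSol M.A (coef k M.S) (fun x => M.pushF R f x - f x) U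
  dirichlet : ZeroTrace U M.Ω₃
  neumann : ∀ φ : E d → ℝ, IsTest M.Ω₃ φ →
    conormalFun M.A (coef k M.S) (fun x => M.pushF R f x - f x) U φ = 0

/-- The transmission problem for `W` in `Ω \ ∂Ω₃`: equation for the reflected coefficients and
source, `W = 0` on `∂Ω`, and `[W] = -U`, `[Â ∇W · η] = -A ∇U · η` on `∂Ω₃`, where
`[w] = w|_ext - w|_int` and `η` is the normal on `∂Ω₃` pointing out of `Ω₃`. The open set
`(closure Ω₃)ᶜ` meets the boundary of `Ω \ ∂Ω₃` in `∂Ω`, and `Ω \ closure Ω₂` meets it in `∂Ω₃`.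
Since `Ω \ ∂Ω₃` lies on both sides of `∂Ω₃`, for test functions supported in `Ω \ closure Ω₂` one
has `traceFun W φ = -∫_{∂Ω₃} [W] φ · η`, and similarly for the conormal derivative. -/
structure Medium.SolvesW (M : Medium d) (R : Reflection d) (k : ℝ) (f : E d → ℂ)
    (U : H1 (M.Ω₃ \ closure M.Ω₂)) (W : H1 (M.Ω \ frontier M.Ω₃)) : Prop where
  eqn : IsWeakSol (M.hatA R) (coef k (M.hat R M.S)) (M.hat R f) W
  dirichlet : ZeroTrace W (closure M.Ω₃)ᶜ
  jump : ∀ φ : E d → E d, IsTest (M.Ω \ closure M.Ω₂) φ →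
    - traceFun W φ = - traceFun U φ
  jump_conormal : ∀ φ : E d → ℝ, IsTest (M.Ω \ closure M.Ω₂) φ →
    - conormalFun (M.hatA R) (coef k (M.hat R M.S)) (M.hat R f) W φ =
      - conormalFun M.A (coef k M.S) (fun x => M.pushF R f x - f x) U φ

/-- The Cauchy problem for `V` in `Ω₃ \ closure Ω₂` with source `h`, and with `V = W|_ext`,
`A ∇V · η = A ∇W · η|_ext` on `∂Ω₃`, where `W` solves `div (A ∇W) + k² Σ W = f` in
`Ω \ closure Ω₃`. The normal pointing out of `Ω \ closure Ω₃` is `-η` on `∂Ω₃`. -/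
structure Medium.SolvesV (M : Medium d) (k : ℝ) (h f : E d → ℂ)
    (W : H1 (M.Ω \ closure M.Ω₃)) (V : H1 (M.Ω₃ \ closure M.Ω₂)) : Prop where
  eqn : IsWeakSol M.A (coef k M.S) h V
  dirichlet : ∀ φ : E d → E d, IsTest (M.Ω \ closure M.Ω₂) φ →
    traceFun V φ = - traceFun W φ
  neumann : ∀ φ : E d → ℝ, IsTest (M.Ω \ closure M.Ω₂) φ →
    conormalFun M.A (coef k M.S) h V φ = - conormalFun M.A (coef k M.S) f W φ

theorem ext_subset (M : Medium d) : M.Ω \ closure M.Ω₃ ⊆ M.Ω \ frontier M.Ω₃ :=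
  fun _ hx => ⟨hx.1, fun h => hx.2 (frontier_subset_closure h)⟩

/-- `f` is compatible with the system: there are `U` and `V` solving their Cauchy problems, where
`W` is the unique solution of the transmission problem determined by `U`. -/
def Medium.Compatible (M : Medium d) (R : Reflection d) (k : ℝ) (f : E d → ℂ) : Prop :=
  ∃ (U V : H1 (M.Ω₃ \ closure M.Ω₂)) (W : H1 (M.Ω \ frontier M.Ω₃)),
    M.SolvesU R k f U ∧
    (M.SolvesW R k f U W ∧ ∀ W' : H1 (M.Ω \ frontier M.Ω₃), M.SolvesW R k f U W' → W'.Eq W) ∧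
    M.SolvesV k f f (W.restrict (ext_subset M)) V

end ReflCompl

end

noncomputable section

namespace ReflCompl

variable {d : ℕ} {D D' N : Set (E d)}

/-! ### Test functions -/

/-! Take `U = 0`. Since `f` vanishes in `Ω₃`, so do its values on `Ω₂` and on `Ω₁`. Hence `F_* f - f
= 0` a.e. in the shell `Ω₃ \ closure Ω₂`, and `f̂ = f` a.e. in `Ω`. Zero therefore solves the first
Cauchy problem, the `H¹₀` solution `W` solves the transmission problem with zero jumps
(`solvesW_zero_of_isH10`), and the given `V` serves unchanged.

The real content is uniqueness in the transmission problem (`Medium.SolvesW.unique`). The difference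
of two solutions has no jump across `∂Ω₃`, which is a null set (`SmoothBoundary.volume_frontier`),
so it glues to an element of `H¹(Ω)` (`H1.extend`). That element solves the homogeneous equation
with zero boundary values and vanishes by well-posedness. Boundary conditions are functionals of
test functions, localized by cutoffs (`IsTest.exists_decomp`).

Splitting these integrals requires integrability, because the integral of a nonintegrable function
is zero by convention. So `Â` and `Σ̂` must be essentially bounded (`bddCoef_hat`), which rests on a
Jacobian bound for `G ∘ F` up to `∂Ω₁` (`exists_jac_comp_bound`). -/

theorem IsTest.mono {V : Type*} [NormedAddCommGroup V] [NormedSpace ℝ V] {φ : E d → V}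
    {N' : Set (E d)} (h : IsTest N φ) (hN : N ⊆ N') : IsTest N' φ :=
  ⟨h.1, h.2.1, h.2.2.trans hN⟩

theorem IsTest.differentiable {V : Type*} [NormedAddCommGroup V] [NormedSpace ℝ V] {φ : E d → V}
    (h : IsTest N φ) : Differentiable ℝ φ :=
  h.1.differentiable (by simp)

theorem IsTest.continuous_pd {V : Type*} [NormedAddCommGroup V] [NormedSpace ℝ V] {φ : E d → V}
    (h : IsTest N φ) (i : Fin d) : Continuous (pd φ i) :=
  (h.1.continuous_fderiv (by simp)).clm_apply continuous_const

theorem IsTest.hasCompactSupport_pd {V : Type*} [NormedAddCommGroup V] [NormedSpace ℝ V]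
    {φ : E d → V} (h : IsTest N φ) (i : Fin d) : HasCompactSupport (pd φ i) :=
  h.2.1.fderiv_apply ℝ _

theorem IsTest.coord {φ : E d → E d} (h : IsTest N φ) (i : Fin d) :
    IsTest N (fun x => φ x i) := by
  have h0 : ∀ x, φ x = 0 → φ x i = 0 := fun x hx => by simp [hx]
  have hs : tsupport (fun x => φ x i) ⊆ tsupport φ :=
    closure_mono fun x hx h' => hx (h0 x h')
  exact ⟨(contDiff_euclidean.1 h.1) i, h.2.1.mono' (fun x hx => hs (subset_closure hx)),
    hs.trans h.2.2⟩

theorem pd_coord {φ : E d → E d} {x : E d} (h : DifferentiableAt ℝ φ x) (i j : Fin d) :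
    pd φ j x i = pd (fun y => φ y i) j x := by
  have := ((EuclideanSpace.proj (𝕜 := ℝ) i).hasFDerivAt.comp x h.hasFDerivAt).fderiv
  simp only [pd]
  change _ = fderiv ℝ ((EuclideanSpace.proj (𝕜 := ℝ) i) ∘ φ) x _
  rw [this]
  rfl

theorem IsTest.single {g : E d → ℝ} (h : IsTest N g) (i : Fin d) :
    IsTest N (fun x => (EuclideanSpace.single i (g x) : E d)) := by
  have hs : tsupport (fun x => (EuclideanSpace.single i (g x) : E d)) ⊆ tsupport g :=
    closure_mono fun x hx h' => hx (by simp [h'])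
  refine ⟨contDiff_euclidean.2 fun j => ?_,
    h.2.1.mono' (fun x hx => hs (subset_closure hx)), hs.trans h.2.2⟩
  by_cases hj : j = i
  · subst hj; simpa using h.1
  · simpa [hj] using contDiff_const

/-- A two-set partition of unity: the part of the support outside `B` is a compact subset of `A`, so
a cutoff equal to `1` near it and supported in `A` does the splitting. This turns vanishing of an
additive functional on `A` and on `B` into vanishing on `A ∪ B`. -/
theorem IsTest.exists_decomp {A B : Set (E d)} (hA : IsOpen A) (hB : IsOpen B) {φ : E d → ℝ}
    (hφ : IsTest (A ∪ B) φ) :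
    ∃ φ₁ φ₂ : E d → ℝ, IsTest A φ₁ ∧ IsTest B φ₂ ∧ φ = fun x => φ₁ x + φ₂ x := by
  have hK : IsCompact (tsupport φ \ B) := hφ.2.1.isCompact.diff hB
  have hKA : tsupport φ \ B ⊆ A := fun x hx => (hφ.2.2 hx.1).resolve_right hx.2
  obtain ⟨L, hL, hKL, hLA⟩ := exists_compact_between hK hA hKA
  obtain ⟨χ, hχ1, hχ0, -⟩ := exists_contMDiffMap_one_nhds_of_subset_interior
    (n := ⊤) (modelWithCornersSelf ℝ (E d)) hK.isClosed hKL
  have hχ : ContDiff ℝ ∞ χ := χ.contMDiff.contDiff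
  have hsχ : tsupport χ ⊆ L := closure_minimal
    (fun x hx => by by_contra h; exact hx (hχ0 x h)) hL.isClosed
  refine ⟨fun x => χ x * φ x, fun x => (1 - χ x) * φ x, ⟨hχ.mul hφ.1, hφ.2.1.mul_left, ?_⟩,
    ⟨(contDiff_const.sub hχ).mul hφ.1, hφ.2.1.mul_left, ?_⟩, by ext x; ring⟩
  · exact (tsupport_mul_subset_left.trans hsχ).trans hLA
  · intro x hx
    -- At a support point outside `B` the cutoff is identically `1` nearby, so the second summand
    -- vanishes there.
    by_contra hxB
    have hxφ : x ∈ tsupport φ := tsupport_mul_subset_right hx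
    have h1 : ∀ᶠ y in 𝓝 x, χ y = 1 := by
      have := (mem_nhdsSet_iff_forall.1 hχ1) x ⟨hxφ, hxB⟩
      exact this
    refine (notMem_tsupport_iff_eventuallyEq.2 ?_) hx
    filter_upwards [h1] with y hy
    simp [hy]

/-! ### Integrability -/

theorem integrable_mul_ofReal {μ : Measure (E d)} [IsFiniteMeasureOnCompacts μ] {u : E d → ℂ}
    (hu : MemLp u 2 μ) {g : E d → ℝ} (hg : Continuous g) (hg' : HasCompactSupport g) :
    Integrable (fun x => u x * (g x : ℂ)) μ := by
  have h : MemLp (fun x => (g x : ℂ)) 2 μ :=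
    (Complex.continuous_ofReal.comp hg).memLp_of_hasCompactSupport
      (hg'.comp_left (g := fun t : ℝ => (t : ℂ)) (by simp))
  exact hu.integrable_mul h

theorem H1.memLp_grad_apply (u : H1 D) (i : Fin d) :
    MemLp (fun x => u.grad x i) 2 (volume.restrict D) :=
  ((EuclideanSpace.proj (𝕜 := ℂ) i).comp_memLp' u.memLp_grad)

theorem H1.integrable_val_mul_pd (u : H1 D) {φ : E d → ℝ} (hφ : IsTest N φ) (i : Fin d) :
    Integrable (fun x => u.val x * ((pd φ i x : ℝ) : ℂ)) (volume.restrict D) :=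
  integrable_mul_ofReal u.memLp_val (hφ.continuous_pd i) (hφ.hasCompactSupport_pd i)

theorem H1.integrable_grad_mul (u : H1 D) {φ : E d → ℝ} (hφ : IsTest N φ) (i : Fin d) :
    Integrable (fun x => u.grad x i * (φ x : ℂ)) (volume.restrict D) :=
  integrable_mul_ofReal (u.memLp_grad_apply i) hφ.1.continuous hφ.2.1

theorem H1.integrable_trace (u : H1 D) {φ : E d → ℝ} (hφ : IsTest N φ) (i : Fin d) :
    Integrable (fun x => u.val x * ((pd φ i x : ℝ) : ℂ) + u.grad x i * (φ x : ℂ))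
      (volume.restrict D) :=
  (u.integrable_val_mul_pd hφ i).add (u.integrable_grad_mul hφ i)

/-! ### The trace functional on scalar test functions -/

/-- The trace of `u` tested with the vector field `φ eᵢ`. -/
def H1.traceCoord (u : H1 D) (i : Fin d) (φ : E d → ℝ) : ℂ :=
  ∫ x in D, (u.val x * ((pd φ i x : ℝ) : ℂ) + u.grad x i * (φ x : ℂ))

theorem H1.traceCoord_add (u : H1 D) (i : Fin d) {φ ψ : E d → ℝ} (hφ : IsTest N φ)
    {N' : Set (E d)} (hψ : IsTest N' ψ) :
    u.traceCoord i (fun x => φ x + ψ x) = u.traceCoord i φ + u.traceCoord i ψ := by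
  unfold H1.traceCoord
  rw [← integral_add (u.integrable_trace hφ i) (u.integrable_trace hψ i)]
  congr 1 with x
  have : pd (fun x => φ x + ψ x) i x = pd φ i x + pd ψ i x := by
    simp only [pd]
    rw [fderiv_fun_add (hφ.differentiable x) (hψ.differentiable x)]
    rfl
  rw [this]
  push_cast
  ring

theorem traceFun_eq_sum (u : H1 D) {φ : E d → E d} (hφ : IsTest N φ) :
    traceFun u φ = ∑ i, u.traceCoord i (fun x => φ x i) := by
  unfold traceFun H1.traceCoord
  rw [← integral_finsetSum _ fun i _ => u.integrable_trace (hφ.coord i) i]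
  congr 1 with x
  rw [Finset.sum_add_distrib, Complex.ofReal_sum, Finset.mul_sum]
  simp only [pd_coord (hφ.differentiable x)]

theorem traceFun_single (u : H1 D) {φ : E d → ℝ} (hφ : IsTest N φ) (i : Fin d) :
    traceFun u (fun x => EuclideanSpace.single i (φ x)) = u.traceCoord i φ := by
  rw [traceFun_eq_sum u (hφ.single i), Finset.sum_eq_single i]
  · simp
  · intro j _ hj
    simp [H1.traceCoord, hj, pd]
  · simp

/-- A field is the sum of its components times the `eᵢ`, so scalar tests suffice, and cutoffs can be
applied to them. -/
theorem zeroTrace_iff (u : H1 D) :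
    ZeroTrace u N ↔ ∀ i, ∀ φ : E d → ℝ, IsTest N φ → u.traceCoord i φ = 0 := by
  refine ⟨fun h i φ hφ => ?_, fun h φ hφ => ?_⟩
  · rw [← traceFun_single u hφ i]
    exact h _ (hφ.single i)
  · rw [traceFun_eq_sum u hφ]
    exact Finset.sum_eq_zero fun i _ => h i _ (hφ.coord i)

theorem ZeroTrace.union {u : H1 D} {A B : Set (E d)} (hA : IsOpen A) (hB : IsOpen B)
    (huA : ZeroTrace u A) (huB : ZeroTrace u B) : ZeroTrace u (A ∪ B) := by
  rw [zeroTrace_iff] at *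
  intro i φ hφ
  obtain ⟨φ₁, φ₂, h₁, h₂, rfl⟩ := hφ.exists_decomp hA hB
  rw [u.traceCoord_add i h₁ h₂, huA i _ h₁, huB i _ h₂, add_zero]

theorem ZeroTrace.mono {u : H1 D} {N' : Set (E d)} (h : ZeroTrace u N) (hN : N' ⊆ N) :
    ZeroTrace u N' :=
  fun φ hφ => h φ (hφ.mono hN)

/-- Inside `D` there is no boundary to see: this is the defining identity of the weak gradient. -/
theorem H1.zeroTrace_self (u : H1 D) : ZeroTrace u D := by
  rw [zeroTrace_iff]
  intro i φ hφ
  rw [H1.traceCoord, integral_add (u.integrable_val_mul_pd hφ i) (u.integrable_grad_mul hφ i),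
    u.weak φ hφ i, neg_add_cancel]

/-! ### Zero, differences and gluing in `H¹` -/

instance : Zero (H1 D) :=
  ⟨{ val := 0, grad := 0, memLp_val := MemLp.zero, memLp_grad := MemLp.zero,
     weak := fun φ _ i => by simp }⟩

theorem H1.zero_val : (0 : H1 D).val = 0 := rfl

theorem H1.zero_grad : (0 : H1 D).grad = 0 := rfl

theorem traceFun_zero (φ : E d → E d) : traceFun (0 : H1 D) φ = 0 := by
  simp [traceFun, H1.zero_val, H1.zero_grad]

instance : Sub (H1 D) :=
  ⟨fun u v =>
    { val := u.val - v.val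
      grad := u.grad - v.grad
      memLp_val := u.memLp_val.sub v.memLp_val
      memLp_grad := u.memLp_grad.sub v.memLp_grad
      weak := fun φ hφ i => by
        simp only [Pi.sub_apply, PiLp.sub_apply, sub_mul]
        rw [integral_sub (u.integrable_val_mul_pd hφ i) (v.integrable_val_mul_pd hφ i),
          integral_sub (u.integrable_grad_mul hφ i) (v.integrable_grad_mul hφ i),
          u.weak φ hφ i, v.weak φ hφ i]
        ring }⟩

theorem H1.sub_val (u v : H1 D) : (u - v).val = u.val - v.val := rfl

theorem H1.sub_grad (u v : H1 D) : (u - v).grad = u.grad - v.grad := rfl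

theorem H1.traceCoord_sub (u v : H1 D) {φ : E d → ℝ} (hφ : IsTest N φ) (i : Fin d) :
    (u - v).traceCoord i φ = u.traceCoord i φ - v.traceCoord i φ := by
  unfold H1.traceCoord
  rw [← integral_sub (u.integrable_trace hφ i) (v.integrable_trace hφ i)]
  congr 1 with x
  simp only [H1.sub_val, H1.sub_grad, Pi.sub_apply, PiLp.sub_apply]
  ring

theorem traceFun_sub (u v : H1 D) {φ : E d → E d} (hφ : IsTest N φ) :
    traceFun (u - v) φ = traceFun u φ - traceFun v φ := by
  rw [traceFun_eq_sum _ hφ, traceFun_eq_sum _ hφ, traceFun_eq_sum _ hφ,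
    ← Finset.sum_sub_distrib]
  exact Finset.sum_congr rfl fun i _ => H1.traceCoord_sub u v (hφ.coord i) i

theorem traceFun_restrict (u : H1 D) (h : D' ⊆ D) (h0 : D' =ᵐ[volume] D) (φ : E d → E d) :
    traceFun (u.restrict h) φ = traceFun u φ := by
  simp only [traceFun, H1.restrict, Measure.restrict_congr_set h0]

/-- A function in `H¹(D')` whose trace vanishes inside `D` belongs to `H¹(D)`, when `D' ⊆ D`
has full measure. -/
def H1.extend (u : H1 D') (h0 : D' =ᵐ[volume] D) (hu : ZeroTrace u D) : H1 D where
  val := u.val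
  grad := u.grad
  memLp_val := by rw [← Measure.restrict_congr_set h0]; exact u.memLp_val
  memLp_grad := by rw [← Measure.restrict_congr_set h0]; exact u.memLp_grad
  weak := fun φ hφ i => by
    have := (zeroTrace_iff u).1 hu i φ hφ
    rw [H1.traceCoord, integral_add (u.integrable_val_mul_pd hφ i)
      (u.integrable_grad_mul hφ i)] at this
    rw [← Measure.restrict_congr_set h0]
    exact eq_neg_of_add_eq_zero_left this

/-! ### Functions in `H¹₀` -/

/-- As `ψ` and its derivatives vanish off `D`, the integral is over the whole space, where
integration by parts has no boundary term, whatever the support of `φ`. -/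
theorem integral_test_mul_pd {ψ : E d → ℂ} (hψ : IsTest D ψ) {φ : E d → ℝ} (hφ : IsTest N φ)
    (i : Fin d) :
    ∫ x in D, (ψ x * ((pd φ i x : ℝ) : ℂ) + pd ψ i x * (φ x : ℂ)) = 0 := by
  have hc : ContDiff ℝ ∞ (fun x => (φ x : ℂ)) := Complex.ofRealCLM.contDiff.comp hφ.1
  have hpd : ∀ x, fderiv ℝ (fun x => (φ x : ℂ)) x (EuclideanSpace.single i 1)
      = ((pd φ i x : ℝ) : ℂ) := fun x => by
    have := (Complex.ofRealCLM.hasFDerivAt.comp x (hφ.differentiable x).hasFDerivAt).fderiv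
    change fderiv ℝ (Complex.ofRealCLM ∘ φ) x _ = _
    rw [this]; rfl
  have hm : ∀ {u : E d → ℂ}, Continuous u → HasCompactSupport u → MemLp u 2 volume :=
    fun h h' => h.memLp_of_hasCompactSupport h'
  have hψL := hm hψ.1.continuous hψ.2.1
  have hψL' := hm (hψ.continuous_pd i) (hψ.hasCompactSupport_pd i)
  have h1 := integrable_mul_ofReal hψL (hφ.continuous_pd i) (hφ.hasCompactSupport_pd i)
  have h2 := integrable_mul_ofReal hψL' hφ.1.continuous hφ.2.1
  have h3 := integrable_mul_ofReal hψL hφ.1.continuous hφ.2.1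
  have key := integral_mul_fderiv_eq_neg_fderiv_mul_of_integrable (μ := volume) (𝕜 := ℂ)
    (f := ψ) (g := fun x => (φ x : ℂ)) (v := EuclideanSpace.single i 1) h2
    (by simpa only [hpd] using h1) h3 (fun x _ => hψ.differentiable x)
    (fun x _ => hc.differentiable (by simp) x)
  simp only [hpd] at key
  rw [setIntegral_eq_integral_of_forall_compl_eq_zero, integral_add h1 h2, key]
  · exact neg_add_cancel _
  · intro x hx
    have a : ψ x = 0 := image_eq_zero_of_notMem_tsupport fun h' => hx (hψ.2.2 h')
    have b : pd ψ i x = 0 := by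
      have h0 : fderiv ℝ ψ x = 0 := by
        by_contra hne
        exact hx (hψ.2.2 (support_fderiv_subset ℝ hne))
      simp [pd, h0]
    simp [a, b]

/-- By Hölder, `L²` convergence against a fixed `L²` function is `L¹` convergence of the products.
-/
theorem tendsto_integral_mul_of_L2 {μ : Measure (E d)} [IsFiniteMeasureOnCompacts μ]
    {u : ℕ → E d → ℂ} {v : E d → ℂ} (hu : ∀ n, MemLp (u n) 2 μ) (hv : MemLp v 2 μ)
    (h : Tendsto (fun n => eLpNorm (fun x => u n x - v x) 2 μ) atTop (𝓝 0))
    {g : E d → ℝ} (hg : Continuous g) (hg' : HasCompactSupport g) :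
    Tendsto (fun n => ∫ x, u n x * (g x : ℂ) ∂μ) atTop (𝓝 (∫ x, v x * (g x : ℂ) ∂μ)) := by
  have hgL : MemLp (fun x => (g x : ℂ)) 2 μ :=
    (Complex.continuous_ofReal.comp hg).memLp_of_hasCompactSupport
      (hg'.comp_left (g := fun t : ℝ => (t : ℂ)) (by simp))
  refine tendsto_integral_of_L1' _ (integrable_mul_ofReal hv hg hg').aestronglyMeasurable
    (Eventually.of_forall fun n => integrable_mul_ofReal (hu n) hg hg') ?_
  have hlim : Tendsto (fun n => eLpNorm (fun x => u n x - v x) 2 μ *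
      eLpNorm (fun x => (g x : ℂ)) 2 μ) atTop (𝓝 0) := by
    have := ENNReal.Tendsto.mul_const h (Or.inr hgL.eLpNorm_ne_top)
    simpa using this
  refine tendsto_of_tendsto_of_tendsto_of_le_of_le tendsto_const_nhds hlim
    (fun _ => zero_le) fun n => ?_
  have := eLpNorm_smul_le_mul_eLpNorm (p := 2) (q := 2) (r := 1) hgL.aestronglyMeasurable
    ((hu n).sub hv).aestronglyMeasurable
  refine le_trans (le_of_eq ?_) this
  congr 1
  ext x
  simp [sub_mul]

/-- The trace functional vanishes on each approximating test function and is continuous in the `H¹`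
norm. -/
theorem H1.IsH10.zeroTrace {u : H1 D} (hu : u.IsH10) : ZeroTrace u univ := by
  rw [zeroTrace_iff]
  intro i φ hφ
  obtain ⟨ψ, hψ, h0, h1⟩ := hu
  have hmem : ∀ {w : E d → ℂ}, Continuous w → HasCompactSupport w →
      MemLp w 2 (volume.restrict D) := fun h h' => h.memLp_of_hasCompactSupport h'
  have hL n := hmem (hψ n).1.continuous (hψ n).2.1
  have hL' n := hmem ((hψ n).continuous_pd i) ((hψ n).hasCompactSupport_pd i)
  have h1' : Tendsto (fun n => eLpNorm (fun x => pd (ψ n) i x - u.grad x i) 2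
      (volume.restrict D)) atTop (𝓝 0) := by
    refine tendsto_of_tendsto_of_tendsto_of_le_of_le tendsto_const_nhds h1
      (fun _ => zero_le) fun n => ?_
    refine eLpNorm_mono fun x => ?_
    exact PiLp.norm_apply_le (WithLp.toLp 2 (fun i => pd (ψ n) i x) - u.grad x) i
  have t0 := tendsto_integral_mul_of_L2 hL u.memLp_val h0 (hφ.continuous_pd i)
    (hφ.hasCompactSupport_pd i)
  have t1 := tendsto_integral_mul_of_L2 hL' (u.memLp_grad_apply i) h1' hφ.1.continuous hφ.2.1
  have t := t0.add t1
  rw [← integral_add (u.integrable_val_mul_pd hφ i) (u.integrable_grad_mul hφ i)] at t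
  refine tendsto_nhds_unique t (tendsto_const_nhds.congr fun n => ?_)
  rw [← integral_add (integrable_mul_ofReal (hL n) (hφ.continuous_pd i)
    (hφ.hasCompactSupport_pd i)) (integrable_mul_ofReal (hL' n) hφ.1.continuous hφ.2.1),
    integral_test_mul_pd (hψ n) hφ i]

/-! ### The conormal derivative -/

/-- The coefficients `a`, `c` are measurable and essentially bounded in `D`. -/
structure BddCoef (D : Set (E d)) (a : E d → Matrix (Fin d) (Fin d) ℝ) (c : E d → ℝ) : Prop where
  mat : ∀ i j, MemLp (fun x => a x i j) ⊤ (volume.restrict D)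
  scalar : MemLp c ⊤ (volume.restrict D)

variable {a : E d → Matrix (Fin d) (Fin d) ℝ} {c : E d → ℝ} {h h' : E d → ℂ}

theorem BddCoef.congr_set (hb : BddCoef D a c) (h0 : D' =ᵐ[volume] D) : BddCoef D' a c := by
  constructor <;> rw [Measure.restrict_congr_set h0]
  exacts [hb.mat, hb.scalar]

theorem memLp_ofReal_mul {μ : Measure (E d)} {g : E d → ℝ} (hg : MemLp g ⊤ μ) {u : E d → ℂ}
    (hu : MemLp u 2 μ) : MemLp (fun x => (g x : ℂ) * u x) 2 μ :=
  MemLp.mul (p := ⊤) (q := 2) hu (hg.ofReal (K := ℂ))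

theorem BddCoef.integrable_flux (hb : BddCoef D a c) (u : H1 D) {φ : E d → ℝ}
    (hφ : IsTest N φ) :
    Integrable (fun x => ∑ i, (∑ j, (a x i j : ℂ) * u.grad x j) * ((pd φ i x : ℝ) : ℂ))
      (volume.restrict D) :=
  integrable_finsetSum _ fun i _ => integrable_mul_ofReal
    (memLp_finsetSum _ fun j _ => memLp_ofReal_mul (hb.mat i j) (u.memLp_grad_apply j))
    (hφ.continuous_pd i) (hφ.hasCompactSupport_pd i)

theorem BddCoef.integrable_lower (hb : BddCoef D a c) (u : H1 D) {φ : E d → ℝ}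
    (hφ : IsTest N φ) :
    Integrable (fun x => (c x : ℂ) * u.val x * (φ x : ℂ)) (volume.restrict D) :=
  integrable_mul_ofReal (memLp_ofReal_mul hb.scalar u.memLp_val) hφ.1.continuous hφ.2.1

theorem BddCoef.integrable_conormal (hb : BddCoef D a c) (hh : MemLp h 2 (volume.restrict D))
    (u : H1 D) {φ : E d → ℝ} (hφ : IsTest N φ) :
    Integrable (fun x => ((∑ i, (∑ j, (a x i j : ℂ) * u.grad x j) * ((pd φ i x : ℝ) : ℂ))
    + (h x - (c x : ℂ) * u.val x) * (φ x : ℂ))) (volume.restrict D) := by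
  simp only [sub_mul]
  exact (hb.integrable_flux u hφ).add ((integrable_mul_ofReal hh hφ.1.continuous hφ.2.1).sub
    (hb.integrable_lower u hφ))

theorem BddCoef.conormalFun_eq (hb : BddCoef D a c) (hh : MemLp h 2 (volume.restrict D))
    (u : H1 D) {φ : E d → ℝ} (hφ : IsTest N φ) :
    conormalFun a c h u φ =
      (∫ x in D, ((∑ i, (∑ j, (a x i j : ℂ) * u.grad x j) * ((pd φ i x : ℝ) : ℂ))
      - (c x : ℂ) * u.val x * (φ x : ℂ))) + ∫ x in D, h x * (φ x : ℂ) := by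
  have h1 : Integrable (fun x => (∑ i, (∑ j, (a x i j : ℂ) * u.grad x j) * ((pd φ i x : ℝ) : ℂ))
      - (c x : ℂ) * u.val x * (φ x : ℂ)) (volume.restrict D) :=
    (hb.integrable_flux u hφ).sub (hb.integrable_lower u hφ)
  rw [← integral_add h1 (integrable_mul_ofReal hh hφ.1.continuous hφ.2.1)]
  unfold conormalFun
  congr 1 with x
  ring

/-- Puts the equation and the conormal conditions in one form, so that both can be combined by a
partition of unity. -/
theorem BddCoef.isWeakSol_iff (hb : BddCoef D a c) (hh : MemLp h 2 (volume.restrict D))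
    (u : H1 D) :
    IsWeakSol a c h u ↔ ∀ φ, IsTest D φ → conormalFun a c h u φ = 0 := by
  refine forall₂_congr fun φ hφ => ?_
  rw [hb.conormalFun_eq hh u hφ, eq_neg_iff_add_eq_zero]

theorem BddCoef.conormalFun_add (hb : BddCoef D a c) (hh : MemLp h 2 (volume.restrict D))
    (u : H1 D) {φ ψ : E d → ℝ} (hφ : IsTest N φ) {N' : Set (E d)} (hψ : IsTest N' ψ) :
    conormalFun a c h u (fun x => φ x + ψ x) =
      conormalFun a c h u φ + conormalFun a c h u ψ := by
  unfold conormalFun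
  rw [← integral_add (hb.integrable_conormal hh u hφ) (hb.integrable_conormal hh u hψ)]
  congr 1 with x
  have : ∀ i, pd (fun x => φ x + ψ x) i x = pd φ i x + pd ψ i x := fun i => by
    simp only [pd]
    rw [fderiv_fun_add (hφ.differentiable x) (hψ.differentiable x)]
    rfl
  simp only [this, Complex.ofReal_add, mul_add, Finset.sum_add_distrib]
  ring

theorem BddCoef.conormalFun_sub (hb : BddCoef D a c) (hh : MemLp h 2 (volume.restrict D))
    (u v : H1 D) {φ : E d → ℝ} (hφ : IsTest N φ) :
    conormalFun a c 0 (u - v) φ = conormalFun a c h u φ - conormalFun a c h v φ := by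
  unfold conormalFun
  rw [← integral_sub (hb.integrable_conormal hh u hφ) (hb.integrable_conormal hh v hφ)]
  congr 1 with x
  simp only [H1.sub_val, H1.sub_grad, Pi.sub_apply, PiLp.sub_apply, Pi.zero_apply, mul_sub,
    sub_mul, Finset.sum_sub_distrib]
  ring

theorem conormalFun_congr (hh : h =ᵐ[volume.restrict D] h') (u : H1 D) (φ : E d → ℝ) :
    conormalFun a c h u φ = conormalFun a c h' u φ := by
  refine integral_congr_ae ?_
  filter_upwards [hh] with x hx
  rw [hx]

theorem IsWeakSol.congr {u : H1 D} (hu : IsWeakSol a c h u)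
    (hh : h =ᵐ[volume.restrict D] h') : IsWeakSol a c h' u := by
  intro φ hφ
  rw [hu φ hφ]
  congr 1
  refine integral_congr_ae ?_
  filter_upwards [hh] with x hx
  rw [hx]

theorem conormalFun_zero (φ : E d → ℝ) : conormalFun a c 0 (0 : H1 D) φ = 0 := by
  simp [conormalFun, H1.zero_val, H1.zero_grad]

theorem isWeakSol_zero : IsWeakSol a c 0 (0 : H1 D) := by
  intro φ _
  simp [H1.zero_val, H1.zero_grad]

theorem conormalFun_restrict (u : H1 D) (hs : D' ⊆ D) (h0 : D' =ᵐ[volume] D) (φ : E d → ℝ) :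
    conormalFun a c h (u.restrict hs) φ = conormalFun a c h u φ := by
  simp only [conormalFun, H1.restrict, Measure.restrict_congr_set h0]

theorem IsWeakSol.restrict {u : H1 D} (hu : IsWeakSol a c h u) (hs : D' ⊆ D)
    (h0 : D' =ᵐ[volume] D) : IsWeakSol a c h (u.restrict hs) := by
  intro φ hφ
  have := hu φ (hφ.mono hs)
  rwa [← Measure.restrict_congr_set h0] at this

end ReflCompl

end

noncomputable section

namespace ReflCompl

variable {d : ℕ} {D D₁ D₂ : Set (E d)} {F G : E d → E d}

/-! ### Smooth boundaries are null sets -/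

theorem volume_coord_eq_zero (i : Fin d) : volume {z : E d | z i = 0} = 0 := by
  have h := Measure.addHaar_submodule (volume : Measure (E d))
    (LinearMap.ker (EuclideanSpace.proj (𝕜 := ℝ) i : E d →L[ℝ] ℝ).toLinearMap) (by
      intro h
      have : (EuclideanSpace.single i 1 : E d) ∈
          LinearMap.ker (EuclideanSpace.proj (𝕜 := ℝ) i : E d →L[ℝ] ℝ).toLinearMap := by
        rw [h]; trivial
      simp at this)
  convert h using 2
  ext z
  simp

/-- In a boundary chart the frontier lies in a coordinate hyperplane, and the smooth inverse chart
maps null sets to null sets. -/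
theorem SmoothBoundary.volume_frontier (hD : SmoothBoundary D) (ho : IsOpen D) :
    volume (frontier D) = 0 := by
  refine measure_null_of_locally_null _ fun x hx => ?_
  obtain ⟨e, i, hxe, -, he', hside⟩ := hD x hx
  refine ⟨frontier D ∩ e.source,
    inter_mem self_mem_nhdsWithin (mem_nhdsWithin_of_mem_nhds (e.open_source.mem_nhds hxe)), ?_⟩
  have hnull : volume (e.symm '' (e.target ∩ {z | z i = 0})) = 0 :=
    addHaar_image_eq_zero_of_differentiableOn_of_addHaar_eq_zero _
      ((he'.differentiableOn (by simp)).mono inter_subset_left)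
      (measure_mono_null inter_subset_right (volume_coord_eq_zero i))
  refine measure_mono_null ?_ hnull
  rintro y ⟨hy, hye⟩
  refine ⟨e y, ⟨e.map_source hye, ?_⟩, e.left_inv hye⟩
  have hle : e y i ≤ 0 := by
    by_contra! h
    exact ((ho.frontier_eq ▸ hy).2) ((hside y hye).2 h)
  refine le_antisymm hle ?_
  -- A negative coordinate would persist near `y`, leaving no points of `D` there, although `y` is
  -- in its closure.
  by_contra! h
  have hc : ContinuousAt (fun z => e z i) y :=
    (EuclideanSpace.proj (𝕜 := ℝ) i).continuous.continuousAt.comp (e.continuousAt hye)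
  have hev : ∀ᶠ z in 𝓝 y, e z i < 0 ∧ z ∈ e.source :=
    (hc.eventually (gt_mem_nhds h)).and (e.open_source.mem_nhds hye)
  obtain ⟨z, ⟨hz, hzs⟩, hzD⟩ :=
    (mem_closure_iff_nhds.1 (frontier_subset_closure hy)) _ hev
  exact absurd ((hside z hzs).1 hzD) (not_lt.2 hz.le)

/-! ### Diffeomorphisms and their inverses -/

theorem IsDiffeoOn.injOn (h : IsDiffeoOn F D₁ D₂) : InjOn F D₁ := by
  obtain ⟨-, -, -, F', -, -, -, hinv⟩ := h
  exact hinv.1.injOn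

theorem IsDiffeoOn.surjOn (h : IsDiffeoOn F D₁ D₂) : SurjOn F D₁ D₂ := by
  obtain ⟨-, -, -, F', -, -, hm, hinv⟩ := h
  exact hinv.2.surjOn hm

theorem IsDiffeoOn.mapsTo (h : IsDiffeoOn F D₁ D₂) : MapsTo F D₁ D₂ := by
  obtain ⟨-, -, -, F', -, hm, -, -⟩ := h
  exact hm

theorem IsDiffeoOn.invFunOn_mem (h : IsDiffeoOn F D₁ D₂) {y : E d} (hy : y ∈ D₂) :
    Function.invFunOn F D₁ y ∈ D₁ :=
  Function.invFunOn_mem (h.surjOn hy)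

theorem IsDiffeoOn.apply_invFunOn (h : IsDiffeoOn F D₁ D₂) {y : E d} (hy : y ∈ D₂) :
    F (Function.invFunOn F D₁ y) = y :=
  Function.invFunOn_eq (h.surjOn hy)

theorem IsDiffeoOn.invFunOn_apply (h : IsDiffeoOn F D₁ D₂) {x : E d} (hx : x ∈ D₁) :
    Function.invFunOn F D₁ (F x) = x :=
  h.injOn.leftInvOn_invFunOn hx

theorem IsDiffeoOn.continuousOn_invFunOn (h : IsDiffeoOn F D₁ D₂) :
    ContinuousOn (Function.invFunOn F D₁) D₂ := by
  have h' := h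
  obtain ⟨-, -, -, F', hF', -, hm, hinv⟩ := h'
  refine hF'.continuousOn.congr fun y hy => ?_
  conv_lhs => rw [← hinv.2 hy]
  exact h.invFunOn_apply (hm hy)

/-- The exceptional set in `D₂` is contained in the image under `F` of the one in `D₁`, and
differentiable maps preserve null sets. -/
theorem IsDiffeoOn.ae_invFunOn (h : IsDiffeoOn F D₁ D₂) {P : E d → Prop}
    (hP : ∀ᵐ x ∂(volume.restrict D₁), P x) :
    ∀ᵐ y ∂(volume.restrict D₂), P (Function.invFunOn F D₁ y) := by
  rw [ae_restrict_iff' h.1.measurableSet, ae_iff] at hP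
  rw [ae_restrict_iff' h.2.1.measurableSet, ae_iff]
  simp only [Classical.not_imp] at *
  refine measure_mono_null ?_
    (addHaar_image_eq_zero_of_differentiableOn_of_addHaar_eq_zero volume
      ((h.2.2.1.differentiableOn (by simp)).mono fun x (hx : x ∈ {x | x ∈ D₁ ∧ ¬P x}) => hx.1) hP)
  rintro y ⟨hy, hPy⟩
  exact ⟨_, ⟨h.invFunOn_mem hy, hPy⟩, h.apply_invFunOn hy⟩

/-- Needed because the coefficients are only a.e. measurable: composition with the inverse must
respect null sets. -/
theorem IsDiffeoOn.map_invFunOn_absolutelyContinuous (h : IsDiffeoOn F D₁ D₂) :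
    (volume.restrict D₂).map (Function.invFunOn F D₁) ≪ volume.restrict D₁ := by
  refine Measure.AbsolutelyContinuous.mk fun s hs h0 => ?_
  rw [Measure.map_apply_of_aemeasurable
    (h.continuousOn_invFunOn.aemeasurable h.2.1.measurableSet) hs]
  have := h.ae_invFunOn (P := fun x => x ∉ s) (measure_eq_zero_iff_ae_notMem.1 h0)
  exact measure_eq_zero_iff_ae_notMem.2 this

theorem IsDiffeoOn.memLp_comp_invFunOn (h : IsDiffeoOn F D₁ D₂) {g : E d → ℝ}
    (hg : MemLp g ⊤ (volume.restrict D₁)) :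
    MemLp (fun y => g (Function.invFunOn F D₁ y)) ⊤ (volume.restrict D₂) := by
  have hb : ∀ᵐ x ∂(volume.restrict D₁), ‖g x‖ ≤ (eLpNormEssSup g (volume.restrict D₁)).toReal := by
    have hlt : eLpNormEssSup g (volume.restrict D₁) ≠ ⊤ := by
      have := hg.2.ne
      rwa [eLpNorm_exponent_top] at this
    filter_upwards [ae_le_eLpNormEssSup (f := g) (μ := volume.restrict D₁)] with x hx
    have := ENNReal.toReal_mono hlt hx
    simpa using this
  refine memLp_top_of_bound ?_ _ (h.ae_invFunOn hb)
  exact (hg.1.mono_ac h.map_invFunOn_absolutelyContinuous).comp_aemeasurable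
    (h.continuousOn_invFunOn.aemeasurable h.2.1.measurableSet)

theorem IsDiffeoOn.pushScalar_ae_eq_zero {V : Type*} [NormedAddCommGroup V] [NormedSpace ℝ V]
    (h : IsDiffeoOn F D₁ D₂) {g : E d → V} (hg : ∀ᵐ x ∂(volume.restrict D₁), g x = 0) :
    ∀ᵐ y ∂(volume.restrict D₂), pushScalar F D₁ g y = 0 := by
  filter_upwards [h.ae_invFunOn hg] with y hy
  simp [pushScalar, hy]

/-! ### Jacobian matrices -/

theorem jac_mulVec (F : E d → E d) (x v : E d) : (jac F x *ᵥ v) = (fderiv ℝ F x v).ofLp := by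
  have hv : v = ∑ j, v j • (EuclideanSpace.single j 1 : E d) := by
    ext i
    simp [Finset.sum_apply, Pi.single_apply]
  ext i
  conv_rhs => rw [hv]
  simp [Matrix.mulVec, dotProduct, jac, pd, mul_comm]

theorem jac_comp {x : E d} (hG : DifferentiableAt ℝ G (F x)) (hF : DifferentiableAt ℝ F x) :
    jac (fun y => G (F y)) x = jac G (F x) * jac F x := by
  ext i j
  have h := congrFun (jac_mulVec G (F x) (fderiv ℝ F x (EuclideanSpace.single j 1))) i
  have h2 : jac (fun y => G (F y)) x i j =
      (fderiv ℝ G (F x) (fderiv ℝ F x (EuclideanSpace.single j 1))) i := by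
    change (fderiv ℝ (G ∘ F) x _) i = _
    rw [fderiv_comp x hG hF]
    rfl
  rw [h2, ← h]
  rfl

theorem jac_congr {x : E d} (h : F =ᶠ[𝓝 x] G) : jac F x = jac G x := by
  ext i j
  simp only [jac, pd, Matrix.of_apply, h.fderiv_eq]

theorem jac_id (x : E d) : jac (fun y => y) x = 1 := by
  ext i j
  simp [jac, pd, Matrix.one_apply]

theorem IsDiffeoOn.differentiableAt (h : IsDiffeoOn F D₁ D₂) {x : E d} (hx : x ∈ D₁) :
    DifferentiableAt ℝ F x :=
  (h.2.2.1.differentiableOn (by simp)).differentiableAt (h.1.mem_nhds hx)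

/-- Chain rule for `F' ∘ F = id`. -/
theorem IsDiffeoOn.det_jac_ne_zero (h : IsDiffeoOn F D₁ D₂) {x : E d} (hx : x ∈ D₁) :
    (jac F x).det ≠ 0 := by
  have h' := h
  obtain ⟨ho, ho', -, F', hF', hm, -, hinv⟩ := h'
  have hd : DifferentiableAt ℝ F' (F x) :=
    (hF'.differentiableOn (by simp)).differentiableAt (ho'.mem_nhds (hm hx))
  have h1 : jac F' (F x) * jac F x = 1 := by
    rw [← jac_comp hd (h.differentiableAt hx), ← jac_id x]
    exact jac_congr (by filter_upwards [ho.mem_nhds hx] with y hy using hinv.1 hy)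
  intro h0
  have := congrArg Matrix.det h1
  simp [h0] at this

theorem continuousOn_jac (h : ContDiffOn ℝ ∞ F D) (ho : IsOpen D) : ContinuousOn (jac F) D := by
  refine continuousOn_pi.2 fun i => continuousOn_pi.2 fun j => ?_
  have h1 : ContinuousOn (fun x => fderiv ℝ F x (EuclideanSpace.single j 1)) D :=
    (h.continuousOn_fderiv_of_isOpen ho (by simp)).clm_apply continuousOn_const
  exact (EuclideanSpace.proj (𝕜 := ℝ) i).continuous.comp_continuousOn h1

/-- If `F` has a local diffeomorphic extension across each boundary point of the bounded open set
`D`, then its Jacobian matrix is bounded in `D`, and the Jacobian determinant is bounded away from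
zero there. -/
theorem exists_jac_bound (hD : IsOpen D) (hb : Bornology.IsBounded D)
    (hloc : ∀ x ∈ closure D, ∃ (P : E d → E d) (N : Set (E d)), IsOpen N ∧ x ∈ N ∧
      ContDiffOn ℝ ∞ P N ∧ (jac P x).det ≠ 0 ∧ EqOn F P (N ∩ D)) :
    ∃ C : ℝ, ∀ x ∈ D, |(jac F x).det|⁻¹ ≤ C ∧ ∀ i j, |jac F x i j| ≤ C := by
  have hcpt : IsCompact (closure D) := hb.isCompact_closure
  have key : ∃ C : ℝ, ∀ x ∈ closure D ∩ D, |(jac F x).det|⁻¹ ≤ C ∧ ∀ i j, |jac F x i j| ≤ C := by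
    refine hcpt.induction_on (p := fun s => ∃ C : ℝ, ∀ x ∈ s ∩ D,
      |(jac F x).det|⁻¹ ≤ C ∧ ∀ i j, |jac F x i j| ≤ C) ⟨0, by simp⟩ ?_ ?_ ?_
    · rintro s t hst ⟨C, hC⟩
      exact ⟨C, fun x hx => hC x ⟨hst hx.1, hx.2⟩⟩
    · rintro s t ⟨C, hC⟩ ⟨C', hC'⟩
      refine ⟨max C C', fun x hx => ?_⟩
      rcases hx.1 with h | h
      · exact ⟨(hC x ⟨h, hx.2⟩).1.trans (le_max_left _ _),
          fun i j => ((hC x ⟨h, hx.2⟩).2 i j).trans (le_max_left _ _)⟩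
      · exact ⟨(hC' x ⟨h, hx.2⟩).1.trans (le_max_right _ _),
          fun i j => ((hC' x ⟨h, hx.2⟩).2 i j).trans (le_max_right _ _)⟩
    · intro x hx
      obtain ⟨P, N, hN, hxN, hP, hdet, hPF⟩ := hloc x hx
      have hc : ContinuousAt (jac P) x := (continuousOn_jac hP hN).continuousAt (hN.mem_nhds hxN)
      have hcd : ContinuousAt (fun y => |(jac P y).det|⁻¹) x := by
        have : ContinuousAt (fun y => (jac P y).det) x :=
          (Continuous.matrix_det continuous_id).continuousAt.comp hc
        exact this.abs.inv₀ (abs_ne_zero.2 hdet)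
      have hcm : ContinuousAt (fun y => ∑ i, ∑ j, |jac P y i j|) x :=
        tendsto_finsetSum _ fun i _ => tendsto_finsetSum _ fun j _ =>
          (continuousAt_pi.1 (continuousAt_pi.1 hc i) j).abs
      -- One continuous sum of nonnegative terms dominates the inverse determinant and every entry
      -- at once, so it stays below `C + 1` near `x`.
      have hsum := hcd.add hcm
      set C := |(jac P x).det|⁻¹ + ∑ i, ∑ j, |jac P x i j|
      have hev : ∀ᶠ y in 𝓝 x, |(jac P y).det|⁻¹ + ∑ i, ∑ j, |jac P y i j| < C + 1 :=
        hsum.eventually (gt_mem_nhds (lt_add_one C))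
      refine ⟨{y | y ∈ N ∧ |(jac P y).det|⁻¹ + ∑ i, ∑ j, |jac P y i j| < C + 1},
        mem_nhdsWithin_of_mem_nhds (Filter.inter_mem (hN.mem_nhds hxN) hev), C + 1, ?_⟩
      rintro y ⟨⟨hyN, hy⟩, hyD⟩
      have hj : jac F y = jac P y := jac_congr (by
        filter_upwards [(hN.inter hD).mem_nhds ⟨hyN, hyD⟩] with z hz using hPF hz)
      rw [hj]
      have h0 : 0 ≤ |(jac P y).det|⁻¹ := inv_nonneg.2 (abs_nonneg _)
      have h1 : 0 ≤ ∑ i, ∑ j, |jac P y i j| :=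
        Finset.sum_nonneg fun i _ => Finset.sum_nonneg fun j _ => abs_nonneg _
      refine ⟨by linarith, fun i j => ?_⟩
      have h2 : |jac P y i j| ≤ ∑ j, |jac P y i j| :=
        Finset.single_le_sum (f := fun j => |jac P y i j|) (fun _ _ => abs_nonneg _)
          (Finset.mem_univ j)
      have h3 : ∑ j, |jac P y i j| ≤ ∑ i, ∑ j, |jac P y i j| :=
        Finset.single_le_sum (f := fun i => ∑ j, |jac P y i j|)
          (fun i _ => Finset.sum_nonneg fun j _ => abs_nonneg _) (Finset.mem_univ i)
      linarith
  obtain ⟨C, hC⟩ := key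
  exact ⟨C, fun x hx => hC x ⟨subset_closure hx, hx⟩⟩

/-! ### Bounded coefficients under push-forward -/

theorem IsDiffeoOn.memLp_jac (h : IsDiffeoOn F D₁ D₂) {C : ℝ}
    (hC : ∀ x ∈ D₁, |(jac F x).det|⁻¹ ≤ C ∧ ∀ i j, |jac F x i j| ≤ C) (i j : Fin d) :
    MemLp (fun x => jac F x i j) ⊤ (volume.restrict D₁) := by
  refine memLp_top_of_bound ?_ C ?_
  · exact (continuousOn_pi.1 (continuousOn_pi.1
      (continuousOn_jac h.2.2.1 h.1) i) j).aestronglyMeasurable h.1.measurableSet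
  · filter_upwards [ae_restrict_mem h.1.measurableSet] with x hx using (hC x hx).2 i j

theorem IsDiffeoOn.memLp_inv_det (h : IsDiffeoOn F D₁ D₂) {C : ℝ}
    (hC : ∀ x ∈ D₁, |(jac F x).det|⁻¹ ≤ C ∧ ∀ i j, |jac F x i j| ≤ C) :
    MemLp (fun x => |(jac F x).det|⁻¹) ⊤ (volume.restrict D₁) := by
  refine memLp_top_of_bound ?_ C ?_
  · have hc : ContinuousOn (fun x => (jac F x).det) D₁ :=
      (Continuous.matrix_det continuous_id).comp_continuousOn (continuousOn_jac h.2.2.1 h.1)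
    exact (hc.abs.inv₀ fun x hx =>
      abs_ne_zero.2 (h.det_jac_ne_zero hx)).aestronglyMeasurable h.1.measurableSet
  · filter_upwards [ae_restrict_mem h.1.measurableSet] with x hx
    rw [Real.norm_of_nonneg (inv_nonneg.2 (abs_nonneg _))]
    exact (hC x hx).1

theorem memLp_top_mul {μ : Measure (E d)} {g h : E d → ℝ} (hg : MemLp g ⊤ μ) (hh : MemLp h ⊤ μ) :
    MemLp (fun x => g x * h x) ⊤ μ :=
  MemLp.mul (p := ⊤) (q := ⊤) hh hg

theorem IsDiffeoOn.memLp_pushScalar (h : IsDiffeoOn F D₁ D₂) {C : ℝ}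
    (hC : ∀ x ∈ D₁, |(jac F x).det|⁻¹ ≤ C ∧ ∀ i j, |jac F x i j| ≤ C) {c : E d → ℝ}
    (hc : MemLp c ⊤ (volume.restrict D₁)) :
    MemLp (pushScalar F D₁ c) ⊤ (volume.restrict D₂) :=
  h.memLp_comp_invFunOn (memLp_top_mul (h.memLp_inv_det hC) hc)

theorem IsDiffeoOn.memLp_pushMatrix (h : IsDiffeoOn F D₁ D₂) {C : ℝ}
    (hC : ∀ x ∈ D₁, |(jac F x).det|⁻¹ ≤ C ∧ ∀ i j, |jac F x i j| ≤ C)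
    {a : E d → Matrix (Fin d) (Fin d) ℝ}
    (ha : ∀ i j, MemLp (fun x => a x i j) ⊤ (volume.restrict D₁)) (i j : Fin d) :
    MemLp (fun y => pushMatrix F D₁ a y i j) ⊤ (volume.restrict D₂) := by
  refine h.memLp_comp_invFunOn
    (g := fun x => (|(jac F x).det|⁻¹ • (jac F x * a x * (jac F x)ᵀ)) i j) ?_
  simp only [Matrix.smul_apply, Matrix.mul_apply, Matrix.transpose_apply, smul_eq_mul]
  exact memLp_top_mul (h.memLp_inv_det hC) (memLp_finsetSum _ fun l _ =>
    memLp_top_mul (memLp_finsetSum _ fun m _ => memLp_top_mul (h.memLp_jac hC i m) (ha m l))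
      (h.memLp_jac hC j l))

/-! ### The reflected medium -/

variable {M : Medium d} {R : Reflection d}

open Classical in
/-- The map `G ∘ F`, completed by `x₁ ↦ x₂`. -/
def Reflection.comp (R : Reflection d) (x : E d) : E d :=
  if x = R.x₁ then R.x₂ else R.G (R.F x)

theorem Medium.ReflectedBy.diffeo_comp (hR : M.ReflectedBy R) :
    IsDiffeoOn R.comp M.Ω₁ M.Ω₃ :=
  hR.diffeo_GF

theorem Reflection.comp_of_ne {x : E d} (hx : x ≠ R.x₁) : R.comp x = R.G (R.F x) :=
  if_neg hx

theorem Medium.Admissible.mem_Ω₂ (hM : M.Admissible) {x : E d} (hx : x ∈ closure M.Ω₁)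
    (hx' : x ≠ R.x₁) : x ∈ M.Ω₂ \ {R.x₁} :=
  ⟨hM.sub₁₂ hx, hx'⟩

theorem jac_reflection_comp (hM : M.Admissible) (hR : M.ReflectedBy R) {x : E d} (hx : x ∈ M.Ω₁)
    (hx' : x ≠ R.x₁) : jac R.comp x = jac R.G (R.F x) * jac R.F x := by
  rw [← jac_comp (hR.diffeo_G.differentiableAt (hR.maps_F ⟨hx, hx'⟩))
    (hR.diffeo_F_ext.differentiableAt (hM.mem_Ω₂ (subset_closure hx) hx'))]
  refine jac_congr ?_
  filter_upwards [isOpen_ne.mem_nhds hx'] with y hy using Reflection.comp_of_ne hy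

/-- Each point of `Ω₃ \ {x₂}` is `G (F x)` for a point `x` of `Ω₁ \ {x₁}`, which is its preimage
under each of the maps involved. -/
theorem Medium.ReflectedBy.preimage (hM : M.Admissible) (hR : M.ReflectedBy R) {y : E d}
    (hy : y ∈ M.Ω₃) (hy' : y ≠ R.x₂) :
    ∃ x ∈ M.Ω₁, x ≠ R.x₁ ∧ Function.invFunOn R.comp M.Ω₁ y = x ∧
      Function.invFunOn R.G (R.Ω₄ \ closure M.Ω₃) y = R.F x ∧
      Function.invFunOn R.F (M.Ω₂ \ {R.x₁}) (R.F x) = x := by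
  have hx := hR.diffeo_comp.invFunOn_mem hy
  have hxy := hR.diffeo_comp.apply_invFunOn hy
  set x := Function.invFunOn R.comp M.Ω₁ y
  have hx' : x ≠ R.x₁ := fun h => hy' (by rw [← hxy, h]; exact if_pos rfl)
  refine ⟨x, hx, hx', rfl, ?_, ?_⟩
  · rw [← hxy, Reflection.comp_of_ne hx']
    exact hR.diffeo_G.invFunOn_apply (hR.maps_F ⟨hx, hx'⟩)
  · exact hR.diffeo_F_ext.invFunOn_apply (hM.mem_Ω₂ (subset_closure hx) hx')

/-- Functoriality of push-forward, from the chain rule. Passing to the composite matters because `G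
∘ F` is smooth across `x₁`, where no bound on the separate Jacobians is available. -/
theorem hatA_eq (hM : M.Admissible) (hR : M.ReflectedBy R) {y : E d} (hy : y ∈ M.Ω₃)
    (hy' : y ≠ R.x₂) : M.hatA R y = pushMatrix R.comp M.Ω₁ M.A y := by
  obtain ⟨x, hx, hx', h1, h2, h3⟩ := hR.preimage hM hy hy'
  rw [Medium.hatA, if_pos hy]
  simp only [pushMatrix, Medium.pushA, h1, h2, h3, jac_reflection_comp hM hR hx hx',
    Matrix.det_mul, abs_mul, mul_inv, Matrix.transpose_mul, Matrix.mul_smul, Matrix.smul_mul,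
    smul_smul, Matrix.mul_assoc]

theorem hat_eq {V : Type*} [NormedAddCommGroup V] [NormedSpace ℝ V] (hM : M.Admissible)
    (hR : M.ReflectedBy R) (g : E d → V) {y : E d} (hy : y ∈ M.Ω₃) (hy' : y ≠ R.x₂) :
    M.hat R g y = pushScalar R.comp M.Ω₁ g y := by
  obtain ⟨x, hx, hx', h1, h2, h3⟩ := hR.preimage hM hy hy'
  rw [Medium.hat, if_pos hy]
  simp only [pushScalar, Medium.pushF, h1, h2, h3, jac_reflection_comp hM hR hx hx',
    Matrix.det_mul, abs_mul, mul_inv, smul_smul]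

/-- If `F x` were outside `closure Ω₃`, then `G (F x)` would also come from a point of `Ω₁`, which
injectivity forces to be `x`. If `F x` were in `Ω₃`, so would be the images of nearby points of
`Ω₁`, contrary to `maps_F`. -/
theorem Medium.ReflectedBy.F_mem_frontier (hM : M.Admissible) (hR : M.ReflectedBy R) {x : E d}
    (hx : x ∈ frontier M.Ω₁) : R.F x ∈ frontier M.Ω₃ := by
  have hxΩ : x ∉ M.Ω₁ := (hM.dom₁.isOpen.frontier_eq ▸ hx).2
  have hx1 : x ≠ R.x₁ := fun h => hxΩ (h ▸ hR.mem_x₁)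
  have hxc : x ∈ closure M.Ω₁ := frontier_subset_closure hx
  have hx2 := hM.mem_Ω₂ (R := R) hxc hx1
  have hFx := hR.diffeo_F_ext.mapsTo hx2
  have hcont : ContinuousAt R.F x := (hR.diffeo_F_ext.differentiableAt hx2).continuousAt
  rw [hM.dom₃.isOpen.frontier_eq]
  constructor
  · by_contra hcl
    have hG := hR.diffeo_G.mapsTo ⟨hFx.1, hcl⟩
    obtain ⟨z, hz, hz', -, h2, h3⟩ := hR.preimage hM hG.1 hG.2
    rw [hR.diffeo_G.invFunOn_apply ⟨hFx.1, hcl⟩] at h2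
    rw [← h2, hR.diffeo_F_ext.invFunOn_apply hx2] at h3
    exact hxΩ (h3 ▸ hz)
  · intro h3
    have hev : ∀ᶠ z in 𝓝 x, R.F z ∈ M.Ω₃ ∧ z ≠ R.x₁ :=
      (hcont.eventually (hM.dom₃.isOpen.mem_nhds h3)).and (isOpen_ne.mem_nhds hx1)
    obtain ⟨z, ⟨hz3, hz1⟩, hz⟩ := mem_closure_iff_nhds.1 hxc _ hev
    exact (hR.maps_F ⟨hz, hz1⟩).2 (subset_closure hz3)

/-- In `Ω₁` the completed map is its own local extension. At `∂Ω₁`, `F` is already smooth on both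
sides and lands on `∂Ω₃`, across which `G` has a diffeomorphic extension. -/
theorem exists_jac_comp_bound (hM : M.Admissible) (hR : M.ReflectedBy R) :
    ∃ C : ℝ, ∀ x ∈ M.Ω₁, |(jac R.comp x).det|⁻¹ ≤ C ∧ ∀ i j, |jac R.comp x i j| ≤ C := by
  refine exists_jac_bound hM.dom₁.isOpen hM.dom₁.isBounded fun x hx => ?_
  by_cases hxΩ : x ∈ M.Ω₁
  · exact ⟨R.comp, M.Ω₁, hM.dom₁.isOpen, hxΩ, hR.diffeo_comp.2.2.1,
      hR.diffeo_comp.det_jac_ne_zero hxΩ, fun _ _ => rfl⟩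
  · have hfr : x ∈ frontier M.Ω₁ := by
      rw [hM.dom₁.isOpen.frontier_eq]; exact ⟨hx, hxΩ⟩
    have hFx := hR.F_mem_frontier hM hfr
    have hx2 := hM.mem_Ω₂ (R := R) hx fun h => hxΩ (h ▸ hR.mem_x₁)
    obtain ⟨G', N, N', hSN, hG', hEq, -⟩ := hR.fix_G
    have hF := hR.diffeo_F_ext
    refine ⟨fun y => G' (R.F y), (M.Ω₂ \ {R.x₁}) ∩ R.F ⁻¹' N,
      hF.2.2.1.continuousOn.isOpen_inter_preimage hF.1 hG'.1, ⟨hx2, hSN hFx⟩, ?_, ?_, ?_⟩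
    · exact hG'.2.2.1.comp (hF.2.2.1.mono inter_subset_left) fun y hy => hy.2
    · rw [jac_comp (hG'.differentiableAt (hSN hFx)) (hF.differentiableAt hx2), Matrix.det_mul]
      exact mul_ne_zero (hG'.det_jac_ne_zero (hSN hFx)) (hF.det_jac_ne_zero hx2)
    · rintro y ⟨⟨hy2, hyN⟩, hy1⟩
      rw [Reflection.comp_of_ne hy2.2]
      exact (hEq ⟨hyN, hR.maps_F ⟨hy1, hy2.2⟩⟩).symm

theorem ae_ne_point [NeZero d] (s : Set (E d)) (x : E d) :
    ∀ᵐ y ∂(volume.restrict s), y ≠ x :=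
  ae_restrict_of_ae (Measure.ae_ne volume x)

theorem memLp_top_of_pieces (h₃ : IsOpen M.Ω₃) (hs : M.Ω₃ ⊆ M.Ω) {g g' : E d → ℝ}
    (hg : MemLp g ⊤ (volume.restrict M.Ω₃)) (hg' : MemLp g' ⊤ (volume.restrict M.Ω))
    (heq : ∀ x ∉ M.Ω₃, g x = g' x) : MemLp g ⊤ (volume.restrict M.Ω) := by
  classical
  have h1 : MemLp g ⊤ ((volume.restrict M.Ω).restrict M.Ω₃) := by
    rwa [Measure.restrict_restrict h₃.measurableSet, inter_eq_left.2 hs]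
  have h2 : MemLp g' ⊤ ((volume.restrict M.Ω).restrict M.Ω₃ᶜ) :=
    hg'.mono_measure Measure.restrict_le_self
  have hgg : g = M.Ω₃.piecewise g g' := by
    funext x
    by_cases hx : x ∈ M.Ω₃
    · simp [hx]
    · simp [hx, heq x hx]
  rw [hgg]
  exact MemLp.piecewise h₃.measurableSet h1 h2

theorem Medium.Admissible.subset₃ (hM : M.Admissible) : M.Ω₃ ⊆ M.Ω :=
  subset_closure.trans hM.sub₃

theorem Medium.Admissible.subset₁ (hM : M.Admissible) : M.Ω₁ ⊆ M.Ω :=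
  ((subset_closure.trans hM.sub₁₂).trans (subset_closure.trans hM.sub₂₃)).trans hM.subset₃

theorem Medium.Admissible.memLp_A (hM : M.Admissible) (i j : Fin d) :
    MemLp (fun x => M.A x i j) ⊤ (volume.restrict M.Ω) := by
  obtain ⟨C, hC⟩ := hM.bdd_A
  exact memLp_top_of_bound (hM.meas_A i j).aestronglyMeasurable C
    (hC.mono fun x hx => hx i j)

theorem Medium.Admissible.memLp_S (hM : M.Admissible) :
    MemLp M.S ⊤ (volume.restrict M.Ω) := by
  obtain ⟨c, C, hc, hC⟩ := hM.bdd_S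
  refine memLp_top_of_bound hM.meas_S.aestronglyMeasurable C (hC.mono fun x hx => ?_)
  rw [Real.norm_of_nonneg (hc.le.trans hx.1)]
  exact hx.2

/-- The coefficients `Â` and `k² Σ̂` of the reflected medium are bounded. -/
theorem bddCoef_hat [NeZero d] (hM : M.Admissible) (hR : M.ReflectedBy R) (k : ℝ) :
    BddCoef M.Ω (M.hatA R) (coef k (M.hat R M.S)) := by
  obtain ⟨C, hC⟩ := exists_jac_comp_bound hM hR
  have hres : ∀ {g : E d → ℝ}, MemLp g ⊤ (volume.restrict M.Ω) →
      MemLp g ⊤ (volume.restrict M.Ω₁) :=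
    fun hg => hg.mono_measure (Measure.restrict_mono hM.subset₁ le_rfl)
  have hae : ∀ᵐ y ∂(volume.restrict M.Ω₃), y ∈ M.Ω₃ ∧ y ≠ R.x₂ :=
    (ae_restrict_mem hM.dom₃.isOpen.measurableSet).and (ae_ne_point _ _)
  constructor
  · intro i j
    refine memLp_top_of_pieces hM.dom₃.isOpen hM.subset₃ ?_ (hM.memLp_A i j) ?_
    · refine (memLp_congr_ae ?_).1 (hR.diffeo_comp.memLp_pushMatrix hC
        (fun i j => hres (hM.memLp_A i j)) i j)
      filter_upwards [hae] with y hy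
      rw [hatA_eq hM hR hy.1 hy.2]
    · intro x hx
      rw [Medium.hatA, if_neg hx]
  · refine (memLp_top_of_pieces hM.dom₃.isOpen hM.subset₃ ?_ hM.memLp_S ?_).const_mul (k ^ 2)
    · refine (memLp_congr_ae ?_).1 (hR.diffeo_comp.memLp_pushScalar hC (hres hM.memLp_S))
      filter_upwards [hae] with y hy
      rw [hat_eq hM hR _ hy.1 hy.2]
    · intro x hx
      rw [Medium.hat, if_neg hx]

/-! ### Sources vanishing in `Ω₃` -/

theorem pushF_ae_eq_zero (hM : M.Admissible) (hR : M.ReflectedBy R) {f : E d → ℂ}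
    (hf : ∀ᵐ x ∂(volume.restrict M.Ω₃), f x = 0) :
    ∀ᵐ y ∂(volume.restrict (R.Ω₄ \ closure M.Ω₂)), M.pushF R f y = 0 :=
  hR.diffeo_F_ext.pushScalar_ae_eq_zero (ae_restrict_of_ae_restrict_of_subset
    (sdiff_subset.trans (subset_closure.trans hM.sub₂₃)) hf)

theorem hat_ae_eq [NeZero d] (hM : M.Admissible) (hR : M.ReflectedBy R) {f : E d → ℂ}
    (hf : ∀ᵐ x ∂(volume.restrict M.Ω₃), f x = 0) :
    M.hat R f =ᵐ[volume.restrict M.Ω] f := by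
  have h1 : ∀ᵐ x ∂(volume.restrict M.Ω₁), f x = 0 :=
    ae_restrict_of_ae_restrict_of_subset
      ((subset_closure.trans hM.sub₁₂).trans (subset_closure.trans hM.sub₂₃)) hf
  have h2 := hR.diffeo_comp.pushScalar_ae_eq_zero h1
  have h3 := ae_ne_point M.Ω₃ R.x₂
  rw [ae_restrict_iff' hM.dom₃.isOpen.measurableSet] at hf h2 h3
  refine ae_restrict_of_ae ?_
  filter_upwards [hf, h2, h3] with y hy1 hy2 hy3
  by_cases hy : y ∈ M.Ω₃
  · rw [hat_eq hM hR f hy (hy3 hy), hy1 hy, hy2 hy]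
  · rw [Medium.hat, if_neg hy]

end ReflCompl

end

noncomputable section

namespace ReflCompl

variable {d : ℕ} {M : Medium d} {R : Reflection d}

/-! ### The transmission problem -/

theorem Medium.Admissible.diff_frontier_ae_eq (hM : M.Admissible) :
    (M.Ω \ frontier M.Ω₃ : Set (E d)) =ᵐ[volume] M.Ω :=
  sdiff_null_ae_eq_self (hM.dom₃.smooth.volume_frontier hM.dom₃.isOpen)

theorem Medium.Admissible.isOpen_outer (hM : M.Admissible) : IsOpen (M.Ω \ closure M.Ω₂) :=
  hM.dom.isOpen.sdiff isClosed_closure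

theorem Medium.Admissible.union_eq (hM : M.Admissible) :
    (M.Ω \ closure M.Ω₂) ∪ M.Ω₃ = M.Ω := by
  refine Subset.antisymm (union_subset sdiff_subset hM.subset₃) fun x hx => ?_
  by_cases h : x ∈ closure M.Ω₂
  · exact Or.inr (hM.sub₂₃ h)
  · exact Or.inl ⟨hx, h⟩

theorem Medium.Admissible.union_compl_eq (hM : M.Admissible) :
    M.Ω ∪ (closure M.Ω₃)ᶜ = univ := by
  refine eq_univ_of_forall fun x => ?_
  by_cases h : x ∈ closure M.Ω₃
  · exact Or.inl (hM.sub₃ h)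
  · exact Or.inr h

theorem Medium.Admissible.subset_diff_frontier (hM : M.Admissible) :
    M.Ω₃ ⊆ M.Ω \ frontier M.Ω₃ := fun _ hx =>
  ⟨hM.subset₃ hx, fun h => (hM.dom₃.isOpen.frontier_eq ▸ h).2 hx⟩

/-- The transmission problem has at most one solution. -/
theorem Medium.SolvesW.unique [NeZero d] {k : ℝ} {f : E d → ℂ}
    {U : H1 (M.Ω₃ \ closure M.Ω₂)} {W W' : H1 (M.Ω \ frontier M.Ω₃)} (hM : M.Admissible)
    (hR : M.ReflectedBy R) (hwp : M.WellPosed R k)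
    (hf : MemLp (M.hat R f) 2 (volume.restrict M.Ω))
    (hW : M.SolvesW R k f U W) (hW' : M.SolvesW R k f U W') : W'.Eq W := by
  have h0 := hM.diff_frontier_ae_eq
  have hbΩ := bddCoef_hat hM hR k
  have hb := hbΩ.congr_set h0
  have hf' : MemLp (M.hat R f) 2 (volume.restrict (M.Ω \ frontier M.Ω₃)) := by
    rwa [Measure.restrict_congr_set h0]
  have htΩ : ZeroTrace (W' - W) M.Ω := by
    -- `Ω` is covered by `Ω \ closure Ω₂`, where the two equal jumps cancel, and `Ω₃`, which does
    -- not meet the removed interface.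
    refine (ZeroTrace.union hM.isOpen_outer hM.dom₃.isOpen (fun φ hφ => ?_)
      ((W' - W).zeroTrace_self.mono hM.subset_diff_frontier)).mono hM.union_eq.ge
    have h1 := hW.jump φ hφ
    have h2 := hW'.jump φ hφ
    rw [traceFun_sub _ _ hφ]
    linear_combination h1 - h2
  have htout : ZeroTrace (W' - W) (closure M.Ω₃)ᶜ := fun φ hφ => by
    rw [traceFun_sub _ _ hφ, hW.dirichlet φ hφ, hW'.dirichlet φ hφ, sub_zero]
  have ht : ZeroTrace (W' - W) univ := by
    rw [← hM.union_compl_eq]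
    exact htΩ.union hM.dom.isOpen isClosed_closure.isOpen_compl htout
  have hcon : ∀ φ, IsTest M.Ω φ →
      conormalFun (M.hatA R) (coef k (M.hat R M.S)) 0 (W' - W) φ = 0 := by
    intro φ hφ
    -- Same cover: the conormal jumps cancel on the first piece, and the equations in `Ω₃` apply on
    -- the second.
    rw [← hM.union_eq] at hφ
    obtain ⟨φ₁, φ₂, hφ₁, hφ₂, rfl⟩ := hφ.exists_decomp hM.isOpen_outer hM.dom₃.isOpen
    rw [hb.conormalFun_add MemLp.zero _ hφ₁ hφ₂, hb.conormalFun_sub hf' _ _ hφ₁,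
      hb.conormalFun_sub hf' _ _ hφ₂]
    have h1 := hW.jump_conormal φ₁ hφ₁
    have h1' := hW'.jump_conormal φ₁ hφ₁
    have h2 := (hb.isWeakSol_iff hf' W).1 hW.eqn φ₂ (hφ₂.mono hM.subset_diff_frontier)
    have h2' := (hb.isWeakSol_iff hf' W').1 hW'.eqn φ₂ (hφ₂.mono hM.subset_diff_frontier)
    linear_combination h1 - h1' - h2 + h2'
  let v : H1 M.Ω := (W' - W).extend h0 htΩ
  have hv : IsWeakSol (M.hatA R) (coef k (M.hat R M.S)) 0 v := by
    refine (hbΩ.isWeakSol_iff MemLp.zero v).2 fun φ hφ => ?_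
    rw [← hcon φ hφ]
    simp only [conormalFun, v, H1.extend, Measure.restrict_congr_set h0]
  have hvt : ZeroTrace v univ := fun φ hφ => by
    rw [← ht φ hφ]
    simp only [traceFun, v, H1.extend, Measure.restrict_congr_set h0]
  have := hwp.full v hv hvt
  rw [← Measure.restrict_congr_set h0] at this
  filter_upwards [this] with x hx
  exact sub_eq_zero.1 hx

/-- A weak solution in `H¹₀(Ω)` solves the transmission problem with zero jumps. -/
theorem solvesW_zero_of_isH10 [NeZero d] {k : ℝ} {f : E d → ℂ} {W : H1 M.Ω}
    (hM : M.Admissible) (hR : M.ReflectedBy R) (hf : MemLp f 2 (volume.restrict M.Ω))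
    (hpush : (fun x => M.pushF R f x - f x) =ᵐ[volume.restrict (M.Ω₃ \ closure M.Ω₂)] 0)
    (hhat : M.hat R f =ᵐ[volume.restrict M.Ω] f) (hW₀ : W.IsH10)
    (hW : IsWeakSol (M.hatA R) (coef k (M.hat R M.S)) f W) :
    M.SolvesW R k f 0 (W.restrict sdiff_subset) := by
  have h0 := hM.diff_frontier_ae_eq
  have hW' := hW.congr hhat.symm
  refine ⟨hW'.restrict _ h0, fun φ hφ => ?_, fun φ hφ => ?_, fun φ hφ => ?_⟩
  · rw [traceFun_restrict _ _ h0]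
    exact hW₀.zeroTrace φ (hφ.mono (subset_univ _))
  · rw [traceFun_restrict _ _ h0, traceFun_zero,
      W.zeroTrace_self φ (hφ.mono sdiff_subset)]
  · rw [conormalFun_restrict _ _ h0, conormalFun_congr hpush, conormalFun_zero,
      ((bddCoef_hat hM hR k).isWeakSol_iff ((memLp_congr_ae hhat).2 hf) W).1 hW' φ
        (hφ.mono sdiff_subset)]

end ReflCompl

end

/-! ### The corollary -/

theorem corollary3p1 {d : ℕ} (hd : d = 2 ∨ d = 3)
    (M : ReflCompl.Medium d) (hM : M.Admissible)
    (R : ReflCompl.Reflection d) (hR : M.ReflectedBy R)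
    (k : ℝ) (hk : 0 < k) (hwp : M.WellPosed R k)
    (f : ReflCompl.E d → ℂ) (hf : MemLp f 2 (volume.restrict M.Ω))
    (hf₃ : ∀ᵐ x ∂(volume.restrict M.Ω₃), f x = 0)
    (W : ReflCompl.H1 M.Ω) (hW₀ : W.IsH10)
    (hW : ReflCompl.IsWeakSol (M.hatA R) (ReflCompl.coef k (M.hat R M.S)) f W)
    (V : ReflCompl.H1 (M.Ω₃ \ closure M.Ω₂))
    (hV : M.SolvesV k 0 f (W.restrict sdiff_subset) V) :
    M.Compatible R k f := by
  -- Positive dimension makes points null, so the exceptional point `x₂` can be ignored.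
  have : NeZero d := ⟨by omega⟩
  have hhat := ReflCompl.hat_ae_eq hM hR hf₃
  have hf0 : f =ᵐ[volume.restrict (M.Ω₃ \ closure M.Ω₂)] 0 :=
    ae_restrict_of_ae_restrict_of_subset sdiff_subset hf₃
  have hpush : (fun x => M.pushF R f x - f x)
      =ᵐ[volume.restrict (M.Ω₃ \ closure M.Ω₂)] 0 := by
    filter_upwards [hf0, ae_restrict_of_ae_restrict_of_subset
      (sdiff_subset_sdiff_left hR.sub₃₄) (ReflCompl.pushF_ae_eq_zero hM hR hf₃)] with x h1 h2
    rw [h1, h2, Pi.zero_apply, sub_zero]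
  have hSW := ReflCompl.solvesW_zero_of_isH10 hM hR hf hpush hhat hW₀ hW
  refine ⟨0, V, W.restrict sdiff_subset, ⟨?_, ?_, ?_⟩, ⟨hSW, fun W' hW' => ?_⟩, ?_, ?_, ?_⟩
  · exact ReflCompl.isWeakSol_zero.congr hpush.symm
  · exact fun φ _ => ReflCompl.traceFun_zero φ
  · intro φ _
    rw [ReflCompl.conormalFun_congr hpush, ReflCompl.conormalFun_zero]
  · exact hSW.unique hM hR hwp ((memLp_congr_ae hhat).2 hf) hW'
  · exact hV.eqn.congr hf0.symm
  · exact hV.dirichlet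
  · intro φ hφ
    rw [ReflCompl.conormalFun_congr hf0]
    exact hV.neumann φ hφ
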